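/- Let $k$ be a field of prime characteristic $p$, let $n,d\ge 0$ be integers with $p\ge\max(n,2d)$, and let $U_n$ be the algebraic group over $k$ of $n\times n$ upper triangular unipotent matrices, with coordinate Hopf algebra $A_n=k[x_{ij}:1\le i<j\le n]$ and generic element $g=1+\sum_{i<j}x_{ij}\varepsilon_{ij}$. Let $\mathfrak u_n$ be its Lie algebra of strictly upper triangular matrices. A representation of $U_n$ on a vector space $V$ is a (right) $A_n$-comodule structure $V\to V\otimes A_n$; when $V$ is finite-dimensional it is identified with its matrix formula, an element of $\operatorname{End}(V)\otimes A_n$. A morphism of representations is a linear map commuting with the coactions. For $M\in\operatorname{End}(V)\otimes A_n$ let $M^{[q]}$ be obtained from $M$ by replacing every variable $x_{ij}$ by $x_{ij}^q$ (scalars unchanged), and let $\log(g)=\sum_{j=1}^{n-1}\frac{(-1)^{j-1}}{j}(g-1)^j$. Call $\Phi=\Phi_0\Phi_1\cdots\Phi_m$ a decomposition of a representation $\Phi$ on $V$ if $$\Phi_i=\bigl(e^{\phi_i(\log g)}\bigr)^{[p^i]}\qquad(0\le i\le m)$$ for Lie algebra homomorphisms $\phi_0,\dots,\phi_m:\mathfrak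 u_n\to\mathfrak{gl}(V)$ such that every $\phi_i(X)$ is nilpotent and $\phi_i(X)$ commutes with $\phi_j(Y)$ for all $i\ne j$ and $X,Y\in\mathfrak u_n$. Theorem. Let $\Phi,\Psi$ be representations of $U_n$ on $k$-vector spaces $V,W$ of dimension at most $d$. Then, for some $m$, both have decompositions $\Phi=\Phi_0\cdots\Phi_m$ and $\Psi=\Psi_0\cdots\Psi_m$. Moreover, for any $m$ and any such decompositions, all $\Phi_i$ and $\Psi_i$ are representations of $U_n$, and a linear map $f:V\to W$ is a morphism $\Phi\to\Psi$ if and only if it is a morphism $\Phi_i\to\Psi_i$ for every $i=0,\dots,m$. -/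

import Mathlib

open scoped TensorProduct

attribute [local instance 100] LieRing.ofAssociativeRing

namespace UnipotentRep

/-- Pairs `(i, j)` with `i < j`: the positions of the coordinates `x_{ij}` on `U_n`. -/
abbrev Pos (n : ℕ) : Type := {ij : Fin n × Fin n // ij.1 < ij.2}

/-- The coordinate ring `A_n = k[x_{ij} : i < j]` of `U_n`. -/
abbrev CoordRing (k : Type*) [Field k] (n : ℕ) : Type _ := MvPolynomial (Pos n) k

/-- The generic element `g` of `U_n`: ones on the diagonal, `x_{ij}` at the places `i < j`. -/
noncomputable def generic (k : Type*) [Field k] (n : ℕ) :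
    Matrix (Fin n) (Fin n) (CoordRing k n) :=
  Matrix.of fun i j => if h : i < j then MvPolynomial.X ⟨(i, j), h⟩ else if i = j then 1 else 0

/-- The comultiplication
`x_{ij} ↦ 1 ⊗ x_{ij} + ∑_{i < l < j} x_{il} ⊗ x_{lj} + x_{ij} ⊗ 1`. -/
noncomputable def comul (k : Type*) [Field k] (n : ℕ) :
    CoordRing k n →ₐ[k] CoordRing k n ⊗[k] CoordRing k n :=
  MvPolynomial.aeval fun r : Pos n =>
    1 ⊗ₜ[k] MvPolynomial.X r +
      ∑ l ∈ Finset.Ioo r.1.1 r.1.2, generic k n r.1.1 l ⊗ₜ[k] generic k n l r.1.2 +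
      MvPolynomial.X r ⊗ₜ[k] 1

/-- The counit `x_{ij} ↦ 0`. -/
noncomputable def counit (k : Type*) [Field k] (n : ℕ) : CoordRing k n →ₐ[k] k :=
  MvPolynomial.aeval fun _ => 0

/-- A `k`-linear map `V → V ⊗ A_n` is a representation of the algebraic group `U_n` on `V` if it
is a (right) comodule structure over `A_n`. -/
structure IsRepresentation {k : Type*} [Field k] {n : ℕ} {V : Type*} [AddCommGroup V] [Module k V]
    (ρ : V →ₗ[k] V ⊗[k] CoordRing k n) : Prop where
  coassoc : (TensorProduct.assoc k V (CoordRing k n) (CoordRing k n)).toLinearMap ∘ₗ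
      LinearMap.rTensor (CoordRing k n) ρ ∘ₗ ρ =
    LinearMap.lTensor V (comul k n).toLinearMap ∘ₗ ρ
  counit_comp : (TensorProduct.rid k V).toLinearMap ∘ₗ
      LinearMap.lTensor V (counit k n).toLinearMap ∘ₗ ρ = LinearMap.id

/-- `f : V → W` is a morphism from the coaction `ρ` on `V` to the coaction `σ` on `W`. -/
def IsMorphism {k : Type*} [Field k] {n : ℕ} {V W : Type*} [AddCommGroup V] [Module k V]
    [AddCommGroup W] [Module k W] (f : V →ₗ[k] W)
    (ρ : V →ₗ[k] V ⊗[k] CoordRing k n) (σ : W →ₗ[k] W ⊗[k] CoordRing k n) : Prop :=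
  LinearMap.rTensor (CoordRing k n) f ∘ₗ ρ = σ ∘ₗ f

/-- The Lie algebra `u_n` of strictly upper triangular `n × n` matrices, with the commutator. -/
def strictUpper (k : Type*) [Field k] (n : ℕ) : LieSubalgebra k (Matrix (Fin n) (Fin n) k) where
  carrier := {M | ∀ i j, j ≤ i → M i j = 0}
  zero_mem' := fun _ _ _ => rfl
  add_mem' := fun {M N} hM hN i j h => by simp [hM i j h, hN i j h]
  smul_mem' := fun c M hM i j h => by simp [hM i j h]
  lie_mem' := fun {M N} hM hN i j h => by
    have key : ∀ P Q : Matrix (Fin n) (Fin n) k, (∀ i j, j ≤ i → P i j = 0) →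
        (∀ i j, j ≤ i → Q i j = 0) → (P * Q) i j = 0 := by
      intro P Q hP hQ
      rw [Matrix.mul_apply]
      refine Finset.sum_eq_zero fun l _ => ?_
      rcases le_total l i with hl | hl
      · rw [hP i l hl, zero_mul]
      · rw [hQ l j (h.trans hl), mul_zero]
    simp [Ring.lie_def, key M N hM hN, key N M hN hM]

/-- The matrix unit `ε_{ij}`, `i < j`, as an element of `u_n`. -/
def matrixUnit (k : Type*) [Field k] {n : ℕ} (r : Pos n) : strictUpper k n :=
  ⟨Matrix.single r.1.1 r.1.2 1, fun i j h => by
    rw [Matrix.single_apply, if_neg]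
    rintro ⟨rfl, rfl⟩
    exact absurd r.2 (not_lt.mpr h)⟩

/-- `log g = ∑_{j=1}^{n-1} (-1)^{j-1} / j (g - 1)^j` for the generic element `g` of `U_n`. -/
noncomputable def logGeneric (k : Type*) [Field k] (n : ℕ) :
    Matrix (Fin n) (Fin n) (CoordRing k n) :=
  ∑ j ∈ Finset.Icc 1 (n - 1), ((-1 : k) ^ (j - 1) * (j : k)⁻¹) • (generic k n - 1) ^ j

/-- `φ(log g) ∈ gl(V) ⊗ A_n`, the value at `log g` of the `A_n`-linear extension of `φ`; here
`log g = ∑_{i<j} (log g)_{ij} ε_{ij}`. -/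
noncomputable def atLog {k : Type*} [Field k] {n : ℕ} {V : Type*} [AddCommGroup V] [Module k V]
    (φ : strictUpper k n →ₗ⁅k⁆ Module.End k V) : Module.End k V ⊗[k] CoordRing k n :=
  ∑ r : Pos n, φ (matrixUnit k r) ⊗ₜ[k] logGeneric k n r.1.1 r.1.2

/-- The exponential series `∑ N^j / j!` of a nilpotent element of a `k`-algebra; it stops at the
nilpotency class of `N`. -/
noncomputable def nilExp (k : Type*) [Field k] {B : Type*} [Ring B] [Algebra k B] (N : B) : B :=
  ∑ j ∈ Finset.range (nilpotencyClass N), ((j.factorial : k)⁻¹) • N ^ j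

/-- `M ↦ M^{[q]}`: every variable `x_{ij}` is replaced by `x_{ij}^q`, scalars are unchanged. -/
noncomputable def powVars (k : Type*) [Field k] (n : ℕ) (V : Type*) [AddCommGroup V] [Module k V]
    (q : ℕ) : Module.End k V ⊗[k] CoordRing k n →ₐ[k] Module.End k V ⊗[k] CoordRing k n :=
  Algebra.TensorProduct.map (AlgHom.id k (Module.End k V)) (MvPolynomial.expand q)

/-- The linear map `V → V ⊗ A_n` with matrix formula `Θ`: for `Θ = ∑ T ⊗ a` it sends `v` to
`∑ T v ⊗ a`. -/
noncomputable def toCoaction {k : Type*} [Field k] {n : ℕ} {V : Type*} [AddCommGroup V]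
    [Module k V] (Θ : Module.End k V ⊗[k] CoordRing k n) : V →ₗ[k] V ⊗[k] CoordRing k n :=
  TensorProduct.rTensorHomToHomRTensor (RingHom.id k) V V (CoordRing k n) Θ

/-- The factor `(e^{φ_i(log g)})^{[p^i]}`. -/
noncomputable def factor {k : Type*} [Field k] {n : ℕ} {V : Type*} [AddCommGroup V] [Module k V]
    (p : ℕ) {m : ℕ} (φ : Fin (m + 1) → (strictUpper k n →ₗ⁅k⁆ Module.End k V)) (i : Fin (m + 1)) :
    Module.End k V ⊗[k] CoordRing k n :=
  powVars k n V (p ^ (i : ℕ)) (nilExp k (atLog (φ i)))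

/-- `φ_0, …, φ_m : u_n → gl(V)` are Lie algebra homomorphisms with nilpotent values that commute
with each other, and `Φ(g) = e^{φ_0(log g)} (e^{φ_1(log g)})^{[p]} ⋯ (e^{φ_m(log g)})^{[p^m]}`. -/
structure IsDecomposition {k : Type*} [Field k] {n : ℕ} {V : Type*} [AddCommGroup V] [Module k V]
    (p : ℕ) {m : ℕ} (φ : Fin (m + 1) → (strictUpper k n →ₗ⁅k⁆ Module.End k V))
    (Φ : V →ₗ[k] V ⊗[k] CoordRing k n) : Prop where
  nilpotent : ∀ i X, IsNilpotent (φ i X)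
  commute : ∀ i j, i ≠ j → ∀ X Y, Commute (φ i X) (φ j Y)
  eq_prod : Φ = toCoaction (List.ofFn fun i => factor p φ i).prod

end UnipotentRep

/-!
Write `Φ` also for the matrix formula of the representation. Its differential at the identity is a
homomorphism `φ₀ : u_n → gl(V)` with nilpotent values, and by Engel's theorem `V` has a flag that
`φ₀` lowers, so `φ₀(log g)` has nilpotency class at most `dim V ≤ p`. Then `e^{φ₀(log g)}` is a
representation: by the formula for the derivative of the exponential, `log g ↦ φ₀(log g)` carries
the equation `D g = g X` to `D Θ = Θ φ₀(X)` for `Θ(g) = e^{φ₀(log g)}`, so the derivatives in `h` of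
`Θ(gh) Θ(h)⁻¹` vanish, and as a polynomial of degree less than `p` in `h` it is constant.

For the same reason the left invariant derivations kill `P = Φ Θ⁻¹`, so `P` is a polynomial in the
`x_{ij}^p`. Differentiating `P(gh) Θ(g) = Φ(g) P(h)` at `g = 1` shows that `φ₀` commutes with `P`.
Hence `P` is a representation, and so is the `Ψ` with `P = Ψ^{[p]}`. Extracting the monomials with
exponents divisible by `p` from `Φ = P Θ` leaves `P`, as `Θ` has degree less than `p`; thus
`deg Ψ ≤ deg Φ / p`, and one iterates.

A linear map intertwining two such products intertwines their differentials, hence their first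
factors; these are invertible, so they cancel, and the rest is a Frobenius twist.
-/

namespace UnipotentRep

/-! ### Truncated exponential and logarithm -/

section TruncatedSeries

open Polynomial Finset

/-- The exponential series truncated below degree `p`. -/
noncomputable def expPoly (k : Type*) [Field k] (p : ℕ) : k[X] :=
  ∑ j ∈ range p, C ((j.factorial : k)⁻¹) * X ^ j

/-- The series of `log (1 + X)` truncated below degree `p`. -/
noncomputable def logPoly (k : Type*) [Field k] (p : ℕ) : k[X] :=
  ∑ j ∈ Icc 1 (p - 1), C ((-1 : k) ^ (j - 1) * (j : k)⁻¹) * X ^ j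

/-- The sum `∑ (1 - e^X)^j` truncated below `j = p`, an inverse of `expPoly k p` modulo `X ^ p`. -/
noncomputable def expInvPoly (k : Type*) [Field k] (p : ℕ) : k[X] :=
  ∑ j ∈ range p, (1 - expPoly k p) ^ j

variable {k : Type*} [Field k] {p : ℕ}

theorem coeff_zero_logPoly : (logPoly k p).coeff 0 = 0 := by
  simp only [logPoly, finsetSum_coeff, coeff_C_mul_X_pow]
  exact Finset.sum_eq_zero fun j hj => if_neg (Nat.succ_le_iff.1 (mem_Icc.1 hj).1).ne

theorem natCast_ne_zero_of_lt_char (k : Type*) [Field k] {p : ℕ} [CharP k p] {j : ℕ} (h0 : j ≠ 0)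
    (h : j < p) : (j : k) ≠ 0 := by
  rw [Ne, CharP.cast_eq_zero_iff k p]
  exact Nat.not_dvd_of_pos_of_lt (Nat.pos_of_ne_zero h0) h

theorem factorial_ne_zero_of_lt_char (k : Type*) [Field k] {p : ℕ} [hp : Fact p.Prime] [CharP k p]
    {j : ℕ} (h : j < p) : (j.factorial : k) ≠ 0 := by
  rwa [Ne, CharP.cast_eq_zero_iff k p, hp.out.dvd_factorial, not_le]

theorem derivative_expPoly_succ (q : ℕ) [CharP k (q + 1)] :
    derivative (expPoly k (q + 1)) = expPoly k (q + 1) - C ((q.factorial : k)⁻¹) * X ^ q := by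
  rw [expPoly, derivative_sum, Finset.sum_range_succ', Finset.sum_range_succ]
  simp only [pow_zero, mul_one, derivative_C, add_zero, add_sub_cancel_right]
  refine Finset.sum_congr rfl fun j hj => ?_
  have hj0 : ((j + 1 : ℕ) : k) ≠ 0 :=
    natCast_ne_zero_of_lt_char k j.succ_ne_zero (Nat.succ_lt_succ (mem_range.1 hj))
  rw [derivative_C_mul_X_pow, Nat.add_sub_cancel, Nat.factorial_succ, Nat.cast_mul, mul_inv,
    mul_comm (((j + 1 : ℕ) : k)⁻¹), mul_assoc, inv_mul_cancel₀ hj0, mul_one]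

theorem X_pow_dvd_of_X_pow_dvd_mul_derivative_sub [CharP k p] {H : k[X]} (h0 : H.coeff 0 = 0)
    (hH : X ^ (p - 1) ∣ (1 + X) * derivative H - H) : X ^ p ∣ H := by
  rw [X_pow_dvd_iff] at hH ⊢
  intro j hj
  induction j with
  | zero => exact h0
  | succ j ih =>
    have hrec := hH j (by omega)
    have hcoeff : (X * derivative H).coeff j = 0 := by
      cases j with
      | zero => simp
      | succ j => rw [coeff_X_mul, coeff_derivative, ih (by omega), zero_mul]
    rw [coeff_sub, add_mul, one_mul, coeff_add, hcoeff, ih (by omega), add_zero, sub_zero,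
      coeff_derivative] at hrec
    exact (mul_eq_zero.1 hrec).resolve_right
      (mod_cast natCast_ne_zero_of_lt_char k j.succ_ne_zero hj)

section Prime

variable [hp : Fact p.Prime]

theorem coeff_zero_expPoly : (expPoly k p).coeff 0 = 1 := by
  rw [expPoly, finsetSum_coeff, Finset.sum_eq_single_of_mem 0 (mem_range.2 hp.out.pos)]
  · simp
  · intro j _ hj
    simp [coeff_X_pow, hj.symm]

theorem X_pow_dvd_expPoly_mul_expInvPoly_sub_one :
    X ^ p ∣ expPoly k p * expInvPoly k p - 1 := by
  have hX : X ∣ 1 - expPoly k p := by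
    rw [X_dvd_iff, coeff_sub, coeff_zero_expPoly, coeff_one_zero, sub_self]
  have hgeom := mul_neg_geom_sum (1 - expPoly k p) p
  rw [sub_sub_cancel] at hgeom
  rw [expInvPoly, hgeom, sub_sub_cancel_left, dvd_neg]
  exact pow_dvd_pow_of_dvd hX p

variable [CharP k p]

theorem one_add_X_mul_derivative_logPoly :
    (1 + X) * derivative (logPoly k p) = 1 - (-X : k[X]) ^ (p - 1) := by
  have hp1 := hp.out.one_lt
  have hderiv : derivative (logPoly k p) = ∑ j ∈ range (p - 1), (-X : k[X]) ^ j := by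
    rw [logPoly, derivative_sum, ← Finset.Ico_succ_right_eq_Icc, Nat.succ_eq_succ,
      Finset.sum_Ico_eq_sum_range]
    refine Finset.sum_congr (by simp) fun j hj => ?_
    have hj0 : ((1 + j : ℕ) : k) ≠ 0 :=
      natCast_ne_zero_of_lt_char k (p := p) (by omega) (by have := mem_range.1 hj; omega)
    rw [derivative_C_mul_X_pow, Nat.add_sub_cancel_left, mul_assoc, inv_mul_cancel₀ hj0, mul_one,
      neg_pow (X : k[X])]
    simp
  rw [hderiv, ← mul_neg_geom_sum, sub_neg_eq_add]

/- Both sides solve `(1 + X) F' = F` modulo `X ^ (p - 1)` and have constant term `1`. -/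
theorem X_pow_dvd_expPoly_comp_logPoly_sub :
    X ^ p ∣ (expPoly k p).comp (logPoly k p) - (1 + X) := by
  have hX : X ∣ logPoly k p := X_dvd_iff.2 coeff_zero_logPoly
  refine X_pow_dvd_of_X_pow_dvd_mul_derivative_sub ?_ ?_
  · rw [coeff_sub, coeff_zero_eq_eval_zero, eval_comp, ← coeff_zero_eq_eval_zero (logPoly k p),
      coeff_zero_logPoly, ← coeff_zero_eq_eval_zero, coeff_zero_expPoly]
    simp
  · obtain ⟨q, rfl⟩ : ∃ q, p = q + 1 := ⟨p - 1, (Nat.succ_pred_prime hp.out).symm⟩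
    have hode : (1 + X) * derivative ((expPoly k (q + 1)).comp (logPoly k (q + 1)) - (1 + X)) -
        ((expPoly k (q + 1)).comp (logPoly k (q + 1)) - (1 + X)) =
        -((-X) ^ q * (derivative (expPoly k (q + 1))).comp (logPoly k (q + 1)) +
          C ((q.factorial : k)⁻¹) * logPoly k (q + 1) ^ q) := by
      rw [derivative_sub, derivative_comp, mul_sub, ← mul_assoc, one_add_X_mul_derivative_logPoly,
        derivative_expPoly_succ]
      simp only [sub_comp, mul_comp, C_comp, X_pow_comp, Nat.add_sub_cancel, derivative_add,
        derivative_one, derivative_X]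
      ring
    rw [hode, dvd_neg, neg_pow (X : k[X]), mul_right_comm, Nat.add_sub_cancel]
    exact dvd_add (Dvd.intro_left _ rfl) (Dvd.dvd.mul_left (pow_dvd_pow_of_dvd hX _) _)

end Prime

section Aeval

variable {S : Type*} [Ring S] [Algebra k S] {N : S}

theorem aeval_eq_of_X_pow_dvd_sub (hN : N ^ p = 0) {f g : k[X]} (h : X ^ p ∣ f - g) :
    aeval N f = aeval N g := by
  obtain ⟨q, hq⟩ := h
  rw [← sub_eq_zero, ← map_sub, hq, map_mul, map_pow, aeval_X, hN, zero_mul]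

theorem aeval_expPoly (N : S) :
    aeval N (expPoly k p) = ∑ j ∈ range p, ((j.factorial : k)⁻¹) • N ^ j := by
  simp only [expPoly, ← smul_eq_C_mul, map_sum, map_smul, map_pow, aeval_X]

theorem aeval_logPoly (N : S) : aeval N (logPoly k p) =
    ∑ j ∈ Icc 1 (p - 1), ((-1 : k) ^ (j - 1) * (j : k)⁻¹) • N ^ j := by
  simp only [logPoly, ← smul_eq_C_mul, map_sum, map_smul, map_pow, aeval_X]

theorem nilExp_eq_aeval_expPoly (hN : N ^ p = 0) : nilExp k N = aeval N (expPoly k p) := by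
  have hle : nilpotencyClass N ≤ p := csInf_le' hN
  rw [nilExp, aeval_expPoly]
  refine Finset.sum_subset (range_subset_range.2 hle) fun j _ hj => ?_
  rw [pow_eq_zero_of_le (not_lt.1 (mem_range.not.1 hj)) (pow_nilpotencyClass ⟨p, hN⟩), smul_zero]

variable [Fact p.Prime]

theorem aeval_expPoly_mul_aeval_expInvPoly (hN : N ^ p = 0) :
    aeval N (expPoly k p) * aeval N (expInvPoly k p) = 1 := by
  rw [← map_mul, aeval_eq_of_X_pow_dvd_sub hN X_pow_dvd_expPoly_mul_expInvPoly_sub_one, map_one]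

theorem aeval_expInvPoly_mul_aeval_expPoly (hN : N ^ p = 0) :
    aeval N (expInvPoly k p) * aeval N (expPoly k p) = 1 := by
  rw [← map_mul, mul_comm, map_mul, aeval_expPoly_mul_aeval_expInvPoly hN]

theorem aeval_aeval_logPoly_expPoly [CharP k p] (hN : N ^ p = 0) :
    aeval (aeval N (logPoly k p)) (expPoly k p) = 1 + N := by
  rw [← aeval_comp, aeval_eq_of_X_pow_dvd_sub hN X_pow_dvd_expPoly_comp_logPoly_sub]
  simp

end Aeval

end TruncatedSeries

section DerivativeOfExp

open Finset Polynomial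

/-- The operator `(1 - e^{-ad Z}) / ad Z = ∑ (-ad Z)^j / (j + 1)!`, truncated below `j = p - 1`,
applied to `W`. When `W = D Z` for a derivation `D`, it is the logarithmic derivative of `e^Z`. -/
noncomputable def dexp (k : Type*) [Field k] (p : ℕ) {S : Type*} [Ring S] [Algebra k S]
    (Z W : S) : S :=
  ∑ j ∈ range (p - 1), ((j + 1).factorial : k)⁻¹ • ((-LieAlgebra.ad k S Z) ^ j) W

section CommRing

variable {k : Type*} [CommRing k] {S : Type*} [Ring S] [Algebra k S]

theorem neg_ad_pow_mul_comm (Z W : S) (j : ℕ) :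
    ((-LieAlgebra.ad k S Z) ^ j) W * Z =
      Z * ((-LieAlgebra.ad k S Z) ^ j) W + ((-LieAlgebra.ad k S Z) ^ (j + 1)) W := by
  rw [pow_succ' _ j, Module.End.mul_apply, LinearMap.neg_apply, LieAlgebra.ad_apply, Ring.lie_def]
  abel

theorem pow_mul_neg_ad_pow_mul_pow_eq_zero {Z W : S} {m : ℕ}
    (hW : ∀ a b, m ≤ a + b → Z ^ a * W * Z ^ b = 0) (j : ℕ) {a b : ℕ} (h : m ≤ a + b + j) :
    Z ^ a * ((-LieAlgebra.ad k S Z) ^ j) W * Z ^ b = 0 := by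
  induction j generalizing a b with
  | zero => simpa using hW a b h
  | succ j ih =>
    have hsucc := eq_sub_of_add_eq' (neg_ad_pow_mul_comm (k := k) Z W j).symm
    rw [hsucc, mul_sub, sub_mul, mul_assoc, mul_assoc _ Z, ← pow_succ', ← mul_assoc,
      ih (by omega), ← mul_assoc, ← pow_succ, ih (by omega), sub_zero]

theorem map_pow_eq_sum_choose_smul {D : S →ₗ[k] S} (hD : ∀ a b, D (a * b) = D a * b + a * D b)
    (Z : S) (m : ℕ) : D (Z ^ m) = ∑ j ∈ range m,
      m.choose (j + 1) • (Z ^ (m - 1 - j) * ((-LieAlgebra.ad k S Z) ^ j) (D Z)) := by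
  induction m with
  | zero => simpa using hD 1 1
  | succ m ih =>
    have hmul : D (Z ^ m) * Z =
        ∑ j ∈ range m, m.choose (j + 1) • (Z ^ (m - j) * ((-LieAlgebra.ad k S Z) ^ j) (D Z)) +
        ∑ j ∈ range m, m.choose (j + 1) •
          (Z ^ (m - (j + 1)) * ((-LieAlgebra.ad k S Z) ^ (j + 1)) (D Z)) := by
      rw [ih, Finset.sum_mul, ← Finset.sum_add_distrib]
      refine Finset.sum_congr rfl fun j hj => ?_
      have hj' : m - j = m - 1 - j + 1 := by have := mem_range.1 hj; omega
      rw [smul_mul_assoc, mul_assoc, neg_ad_pow_mul_comm, mul_add, smul_add, ← mul_assoc,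
        ← pow_succ, ← hj', Nat.sub_sub, add_comm 1 j]
    have hshift := Finset.sum_range_succ' (fun j => m.choose j •
      (Z ^ (m - j) * ((-LieAlgebra.ad k S Z) ^ j) (D Z))) m
    rw [Nat.choose_zero_right, one_smul, Nat.sub_zero, pow_zero, Module.End.one_apply] at hshift
    rw [pow_succ, hD, hmul, add_assoc, ← hshift, Nat.add_sub_cancel]
    simp only [Nat.choose_succ_succ, add_smul, Finset.sum_add_distrib]
    rw [Finset.sum_range_succ (fun j => m.choose (j + 1) • _), Nat.choose_succ_self, zero_smul,
      add_zero, add_comm]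

end CommRing

variable {k : Type*} [Field k] {p : ℕ} {S : Type*} [Ring S] [Algebra k S]

section Derivative

variable [hp : Fact p.Prime] [CharP k p]

theorem inv_factorial_mul_choose {s j : ℕ} (hs : s < p) (hj : j ≤ s) :
    (s.factorial : k)⁻¹ * s.choose j = (j.factorial : k)⁻¹ * ((s - j).factorial : k)⁻¹ := by
  have hs0 := factorial_ne_zero_of_lt_char k hs
  have hj0 := factorial_ne_zero_of_lt_char k (hj.trans_lt hs)
  have hsj0 := factorial_ne_zero_of_lt_char k ((Nat.sub_le s j).trans_lt hs)
  have hchoose : (s.choose j : k) * j.factorial * (s - j).factorial = s.factorial := by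
    exact_mod_cast congrArg (Nat.cast : ℕ → k) (Nat.choose_mul_factorial_mul_factorial hj)
  field_simp
  linear_combination hchoose

theorem map_aeval_expPoly {D : S →ₗ[k] S} (hD : ∀ a b, D (a * b) = D a * b + a * D b) {Z : S}
    (hZ : ∀ a b, p - 1 ≤ a + b → Z ^ a * D Z * Z ^ b = 0) :
    D (aeval Z (expPoly k p)) = aeval Z (expPoly k p) * dexp k p Z (D Z) := by
  obtain ⟨q, rfl⟩ : ∃ q, p = q + 1 := ⟨p - 1, (Nat.succ_pred_prime hp.out).symm⟩
  rw [Nat.add_sub_cancel] at hZ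
  let term (j m : ℕ) : S := (((j + 1).factorial : k)⁻¹ * (m.factorial : k)⁻¹) •
    (Z ^ m * ((-LieAlgebra.ad k S Z) ^ j) (D Z))
  have hterm : ∀ j m, q ≤ m + j → term j m = 0 := fun j m h => by
    have := pow_mul_neg_ad_pow_mul_pow_eq_zero (k := k) hZ j (a := m) (b := 0) (by omega)
    rw [pow_zero, mul_one] at this
    rw [show term j m = _ • _ from rfl, this, smul_zero]
  have hsummand : ∀ s ∈ range q, ((s + 1).factorial : k)⁻¹ • D (Z ^ (s + 1)) =
      ∑ j ∈ range (s + 1), term j (s - j) := fun s hs => by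
    rw [map_pow_eq_sum_choose_smul hD, Finset.smul_sum]
    refine Finset.sum_congr rfl fun j hj => ?_
    rw [← Nat.cast_smul_eq_nsmul k, smul_smul, inv_factorial_mul_choose (p := q + 1)
      (Nat.succ_lt_succ (mem_range.1 hs)) (Nat.succ_le_of_lt (mem_range.1 hj)),
      Nat.add_sub_cancel, Nat.succ_sub_succ]
  have hconst : D (Z ^ 0) = 0 := by simpa using hD 1 1
  calc D (aeval Z (expPoly k (q + 1)))
      = ∑ s ∈ range q, ((s + 1).factorial : k)⁻¹ • D (Z ^ (s + 1)) := by
        rw [aeval_expPoly, map_sum, Finset.sum_range_succ']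
        simp only [map_smul, hconst, smul_zero, add_zero]
    _ = ∑ j ∈ range q, ∑ m ∈ range (q - j), term j m := by
        rw [Finset.sum_congr rfl hsummand, Finset.sum_range_diag_flip q term]
    _ = ∑ j ∈ range q, ∑ m ∈ range (q + 1), term j m := by
        refine Finset.sum_congr rfl fun j _ =>
          Finset.sum_subset (range_subset_range.2 (by omega)) fun m _ hm => hterm j m ?_
        have := mem_range.not.1 hm
        omega
    _ = aeval Z (expPoly k (q + 1)) * dexp k (q + 1) Z (D Z) := by
        rw [aeval_expPoly, dexp, Finset.sum_mul_sum, Finset.sum_comm, Nat.add_sub_cancel]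
        simp only [smul_mul_smul_comm, mul_comm, term]

end Derivative

theorem map_dexp {S' : Type*} [Ring S'] [Algebra k S'] {f : S →ₗ[k] S'} {L : Submodule k S}
    {Z W : S} (hL : ∀ Y ∈ L, ⁅Z, Y⁆ ∈ L) (hf : ∀ Y ∈ L, f ⁅Z, Y⁆ = ⁅f Z, f Y⁆) (hW : W ∈ L) :
    f (dexp k p Z W) = dexp k p (f Z) (f W) := by
  have hpow : ∀ j, ((-LieAlgebra.ad k S Z) ^ j) W ∈ L ∧
      f (((-LieAlgebra.ad k S Z) ^ j) W) = ((-LieAlgebra.ad k S' (f Z)) ^ j) (f W) := by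
    intro j
    induction j with
    | zero => exact ⟨hW, rfl⟩
    | succ j ih =>
      simp only [pow_succ', Module.End.mul_apply, LinearMap.neg_apply, LieAlgebra.ad_apply]
      exact ⟨neg_mem (hL _ ih.1), by rw [map_neg, hf _ ih.1, ih.2]⟩
  simp only [dexp, map_sum, map_smul, (hpow _).2]

end DerivativeOfExp

/-! ### Coefficients, Frobenius contraction and strictly upper triangular matrices -/

section TensorTools

variable {k : Type*} [CommRing k] {B : Type*} [Ring B] [Algebra k B]

section CoeffMap

variable {R R' R'' : Type*} [CommRing R] [Algebra k R] [CommRing R'] [Algebra k R'] [CommRing R'']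
  [Algebra k R'']

theorem lTensor_derivation_mul (D : Derivation k R R) (x y : B ⊗[k] R) :
    (D : R →ₗ[k] R).lTensor B (x * y) =
      (D : R →ₗ[k] R).lTensor B x * y + x * (D : R →ₗ[k] R).lTensor B y := by
  induction x with
  | zero => simp
  | add x x' hx hx' => simp only [add_mul, map_add, hx, hx']; abel
  | tmul b r =>
    induction y with
    | zero => simp
    | add y y' hy hy' => simp only [mul_add, map_add, hy, hy']; abel
    | tmul c s =>
      simp only [Algebra.TensorProduct.tmul_mul_tmul, LinearMap.lTensor_tmul,
        Derivation.coeFn_coe, Derivation.leibniz, smul_eq_mul, TensorProduct.tmul_add]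
      rw [add_comm, mul_comm s]

/-- Change of coefficient ring in `B ⊗ R`. -/
noncomputable def coeffMap (B : Type*) [Ring B] [Algebra k B] (h : R →ₐ[k] R') :
    B ⊗[k] R →ₐ[k] B ⊗[k] R' :=
  Algebra.TensorProduct.map (AlgHom.id k B) h

@[simp]
theorem coeffMap_tmul (h : R →ₐ[k] R') (b : B) (r : R) :
    coeffMap B h (b ⊗ₜ[k] r) = b ⊗ₜ[k] h r := rfl

theorem coeffMap_apply (h : R →ₐ[k] R') (x : B ⊗[k] R) :
    coeffMap B h x = h.toLinearMap.lTensor B x := rfl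

theorem coeffMap_coeffMap (u : R' →ₐ[k] R'') (v : R →ₐ[k] R') (x : B ⊗[k] R) :
    coeffMap B u (coeffMap B v x) = coeffMap B (u.comp v) x :=
  (LinearMap.lTensor_comp_apply B u.toLinearMap v.toLinearMap x).symm

theorem coeffMap_id (x : B ⊗[k] R) : coeffMap B (AlgHom.id k R) x = x :=
  LinearMap.lTensor_id_apply B R x

theorem coeffMap_injective [Module.Flat k B] {u : R →ₐ[k] R'} (hu : Function.Injective u) :
    Function.Injective (coeffMap B u) :=
  Module.Flat.lTensor_preserves_injective_linearMap u.toLinearMap hu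

end CoeffMap

section Slice

variable {k : Type*} [CommSemiring k] {B M N : Type*} [AddCommMonoid B] [Module k B]
  [AddCommMonoid M] [Module k M] [AddCommMonoid N] [Module k N]

/-- The contraction of `B ⊗ M` with a linear form on `B`. -/
noncomputable def slice (l : Module.Dual k B) : B ⊗[k] M →ₗ[k] M :=
  (TensorProduct.lid k M).toLinearMap ∘ₗ l.rTensor M

@[simp]
theorem slice_tmul (l : Module.Dual k B) (b : B) (m : M) : slice l (b ⊗ₜ[k] m) = l b • m := by
  simp [slice]

theorem slice_lTensor (l : Module.Dual k B) (f : M →ₗ[k] N) (x : B ⊗[k] M) :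
    slice l (f.lTensor B x) = f (slice l x) := by
  induction x with
  | zero => simp
  | add x y hx hy => simp [hx, hy]
  | tmul b m => simp

theorem eq_of_slice_eq [Module.Free k B] {x y : B ⊗[k] M}
    (h : ∀ l : Module.Dual k B, slice l x = slice l y) : x = y := by
  classical
  let b := Module.Free.chooseBasis k B
  refine (TensorProduct.equivFinsuppOfBasisLeft b).injective (Finsupp.ext fun i => ?_)
  simp only [TensorProduct.equivFinsuppOfBasisLeft_apply]
  exact h (b.coord i)

end Slice

end TensorTools

section PolynomialTools

open MvPolynomial

variable {σ : Type*}

section Pderiv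

variable {R : Type*} [CommRing R] {f : MvPolynomial σ R}

theorem dvd_of_pderiv_eq_zero (k : Type*) [Field k] {p : ℕ} [CharP k p] [Algebra k R]
    (hf : ∀ r, pderiv r f = 0) {m : σ →₀ ℕ} (hm : m ∈ f.support) (r : σ) :
    p ∣ m r := by
  rcases Nat.eq_zero_or_pos (m r) with h0 | hpos
  · simp [h0]
  have hcoeff := coeff_pderiv (i := r) f (m - Finsupp.single r 1)
  have hm' : m - Finsupp.single r 1 + Finsupp.single r 1 = m :=
    tsub_add_cancel_of_le (Finsupp.single_le_iff.2 hpos)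
  rw [hm', hf, coeff_zero, Finsupp.tsub_apply, Finsupp.single_eq_same, ← Nat.cast_succ,
    Nat.succ_eq_add_one, Nat.sub_add_cancel hpos, ← map_natCast (algebraMap k R), mul_comm,
    ← Algebra.smul_def] at hcoeff
  by_contra hdvd
  rw [← CharP.cast_eq_zero_iff k p] at hdvd
  exact mem_support_iff.1 hm ((smul_eq_zero_iff_right hdvd).1 hcoeff.symm)

theorem eq_C_of_pderiv_eq_zero (k : Type*) [Field k] {p : ℕ} [CharP k p] [Algebra k R]
    (hf : ∀ r, pderiv r f = 0) (hdeg : f.totalDegree < p) : f = C (coeff 0 f) := by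
  refine totalDegree_eq_zero_iff_eq_C.1 ((totalDegree_eq_zero_iff _ _).2 fun m hm r => ?_)
  have hle : m r ≤ f.totalDegree := (Finsupp.le_degree r m).trans (le_totalDegree hm)
  exact Nat.eq_zero_of_dvd_of_lt (dvd_of_pderiv_eq_zero k hf hm r) (hle.trans_lt hdeg)

end Pderiv

variable {R : Type*} [CommSemiring R] {p : ℕ} [NeZero p]

/-- The linear map with `x^{p m} ↦ x^m`, which kills the other monomials; a left inverse of
`MvPolynomial.expand p`. -/
noncomputable def contract (p : ℕ) [NeZero p] : MvPolynomial σ R →ₗ[R] MvPolynomial σ R :=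
  (basisMonomials σ R).repr.symm.toLinearMap ∘ₗ
    Finsupp.lcomapDomain (p • ·) (nsmul_right_injective (NeZero.ne p)) ∘ₗ
      (basisMonomials σ R).repr.toLinearMap

theorem coeff_contract (f : MvPolynomial σ R) (m : σ →₀ ℕ) :
    coeff m (contract p f) = coeff (p • m) f := rfl

theorem expand_contract {f : MvPolynomial σ R} (hf : ∀ m ∈ f.support, ∀ r, p ∣ m r) :
    expand p (contract p f) = f := by
  ext m
  by_cases hm : ∀ r, p ∣ m r
  · obtain ⟨m', rfl⟩ : ∃ m', m = p • m' :=
      ⟨m.mapRange (· / p) (Nat.zero_div p), by ext r; simp [Nat.mul_div_cancel' (hm r)]⟩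
    rw [coeff_expand_smul p (NeZero.ne p), coeff_contract]
  · obtain ⟨r, hr⟩ := not_forall.1 hm
    rw [coeff_expand_of_not_dvd _ hr, eq_comm, ← notMem_support_iff]
    exact fun h => hr (hf m h r)

theorem totalDegree_contract_le (f : MvPolynomial σ R) :
    (contract p f).totalDegree ≤ f.totalDegree / p := by
  refine Finset.sup_le fun m hm => ?_
  rw [Nat.le_div_iff_mul_le (NeZero.pos p)]
  have hdeg : (p • m).degree ≤ f.totalDegree :=
    le_totalDegree (mem_support_iff.2 (coeff_contract (p := p) f m ▸ mem_support_iff.1 hm))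
  rwa [map_nsmul, smul_eq_mul, mul_comm] at hdeg

theorem contract_expand_mul (f g : MvPolynomial σ R) :
    contract p (expand p f * g) = f * contract p g := by
  induction f using MvPolynomial.induction_on' with
  | monomial m c =>
    ext m'
    rw [coeff_contract, expand_monomial, coeff_monomial_mul', coeff_monomial_mul',
      coeff_contract]
    have hle : p • m ≤ p • m' ↔ m ≤ m' := by simp [Finsupp.le_def, NeZero.pos p]
    have hsub : p • m' - p • m = p • (m' - m) := by ext r; simp [Nat.mul_sub]
    simp only [hle, hsub]
  | add f₁ f₂ h₁ h₂ => rw [map_add, add_mul, map_add, h₁, h₂, add_mul]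

theorem constantCoeff_contract (f : MvPolynomial σ R) :
    constantCoeff (contract p f) = constantCoeff f := by
  rw [constantCoeff_eq, coeff_contract, smul_zero]

end PolynomialTools

section Band

variable {n : ℕ} {R : Type*} [CommRing R]

/-- The matrices that vanish below the `m`-th superdiagonal. -/
def band (n : ℕ) (R : Type*) [CommRing R] (m : ℕ) : Submodule R (Matrix (Fin n) (Fin n) R) where
  carrier := {M | ∀ i j : Fin n, (j : ℕ) < i + m → M i j = 0}
  zero_mem' := fun _ _ _ => rfl
  add_mem' := fun {M N} hM hN i j h => by simp [hM i j h, hN i j h]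
  smul_mem' := fun c M hM i j h => by simp [hM i j h]

theorem band_antitone : Antitone (band n R) := fun _ _ h _ hM i j hij => hM i j (by omega)

theorem mul_mem_band {a b : ℕ} {M N : Matrix (Fin n) (Fin n) R} (hM : M ∈ band n R a)
    (hN : N ∈ band n R b) : M * N ∈ band n R (a + b) := by
  intro i j hij
  rw [Matrix.mul_apply]
  refine Finset.sum_eq_zero fun l _ => ?_
  by_cases hl : (l : ℕ) < i + a
  · rw [hM i l hl, zero_mul]
  · rw [hN l j (by omega), mul_zero]

theorem lie_mem_band {a b : ℕ} {M N : Matrix (Fin n) (Fin n) R} (hM : M ∈ band n R a)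
    (hN : N ∈ band n R b) : ⁅M, N⁆ ∈ band n R (a + b) :=
  sub_mem (mul_mem_band hM hN) (add_comm b a ▸ mul_mem_band hN hM)

theorem one_mem_band : (1 : Matrix (Fin n) (Fin n) R) ∈ band n R 0 := fun i j hij =>
  Matrix.one_apply_ne (by rintro rfl; omega)

theorem pow_mem_band {M : Matrix (Fin n) (Fin n) R} (hM : M ∈ band n R 1) (a : ℕ) :
    M ^ a ∈ band n R a := by
  induction a with
  | zero => simpa using one_mem_band
  | succ a ih => rw [pow_succ]; exact mul_mem_band ih hM

theorem eq_zero_of_mem_band {m : ℕ} (hm : n ≤ m) {M : Matrix (Fin n) (Fin n) R}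
    (hM : M ∈ band n R m) : M = 0 := by
  ext i j
  exact hM i j (by omega)

theorem map_mem_band {R' : Type*} [CommRing R'] {m : ℕ} {M : Matrix (Fin n) (Fin n) R}
    (hM : M ∈ band n R m) {f : R → R'} (hf : f 0 = 0) : M.map f ∈ band n R' m := fun i j hij => by
  rw [Matrix.map_apply, hM i j hij, hf]

theorem mem_band_zero_of_sub_one_mem {g : Matrix (Fin n) (Fin n) R} (hg : g - 1 ∈ band n R 1) :
    g ∈ band n R 0 := by
  rw [← sub_add_cancel g 1]
  exact add_mem (band_antitone zero_le_one hg) one_mem_band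

theorem map_sub_one_mem_band {R' : Type*} [CommRing R'] {g : Matrix (Fin n) (Fin n) R}
    (hg : g - 1 ∈ band n R 1) (f : R →+* R') : g.map f - 1 ∈ band n R' 1 := by
  have h := map_mem_band hg (map_zero f)
  rwa [Matrix.map_sub _ (map_sub f), Matrix.map_one _ (map_zero f) (map_one f)] at h

theorem mul_sub_one_mem_band {g h : Matrix (Fin n) (Fin n) R} (hg : g - 1 ∈ band n R 1)
    (hh : h - 1 ∈ band n R 1) : g * h - 1 ∈ band n R 1 := by
  have : g * h - 1 = (g - 1) * (h - 1) + (g - 1) + (h - 1) := by noncomm_ring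
  rw [this]
  exact add_mem (add_mem (band_antitone (by omega) (mul_mem_band hg hh)) hg) hh

theorem exists_inverse {g : Matrix (Fin n) (Fin n) R} (hg : g - 1 ∈ band n R 1) :
    ∃ g' ∈ band n R 0, g * g' = 1 ∧ g' * g = 1 := by
  have hN : 1 - g ∈ band n R 1 := by rw [← neg_sub]; exact neg_mem hg
  refine ⟨∑ j ∈ Finset.range n, (1 - g) ^ j, sum_mem fun j _ =>
    band_antitone (Nat.zero_le _) (pow_mem_band hN j), ?_, ?_⟩
  · have := mul_neg_geom_sum (1 - g) n
    rwa [sub_sub_cancel, eq_zero_of_mem_band le_rfl (pow_mem_band hN n), sub_zero] at this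
  · have := geom_sum_mul_neg (1 - g) n
    rwa [sub_sub_cancel, eq_zero_of_mem_band le_rfl (pow_mem_band hN n), sub_zero] at this

theorem eq_sum_single {M : Matrix (Fin n) (Fin n) R} (hM : M ∈ band n R 1) :
    M = ∑ r : Pos n, Matrix.single r.1.1 r.1.2 (M r.1.1 r.1.2) := by
  ext i j
  rw [Matrix.sum_apply]
  by_cases hij : i < j
  · rw [Finset.sum_eq_single ⟨(i, j), hij⟩]
    · simp
    · rintro ⟨⟨a, b⟩, hab⟩ _ hne
      rw [Matrix.single_apply, if_neg]
      rintro ⟨rfl, rfl⟩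
      exact hne rfl
    · simp
  · rw [hM i j (by omega)]
    refine (Finset.sum_eq_zero fun r _ => ?_).symm
    rw [Matrix.single_apply, if_neg]
    rintro ⟨rfl, rfl⟩
    exact hij r.2

end Band

section Extend

section ScalarMatrix

variable {k : Type*} [CommSemiring k] {n : Type*} [Fintype n] {R : Type*} [Semiring R] [Algebra k R]

theorem map_smul_mul_map_smul (X Y : Matrix n n k) (a b : R) :
    (X.map fun c => c • a) * (Y.map fun c => c • b) = (X * Y).map fun c => c • (a * b) := by
  ext i j
  simp [Matrix.mul_apply, Finset.sum_smul, smul_smul, mul_comm]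

end ScalarMatrix

variable {k : Type*} [Field k] {n : ℕ} {B : Type*} [Ring B] [Algebra k B]

/-- The extension of scalars of `φ` to strictly upper triangular matrices over `R`, extended by
zero to all matrices. -/
noncomputable def extend (φ : strictUpper k n →ₗ⁅k⁆ B) (R : Type*) [CommRing R] [Algebra k R] :
    Matrix (Fin n) (Fin n) R →ₗ[k] B ⊗[k] R :=
  ∑ r : Pos n, (TensorProduct.mk k B R (φ (matrixUnit k r))) ∘ₗ
    (Matrix.entryLinearMap k R r.1.1 r.1.2)

variable {R : Type*} [CommRing R] [Algebra k R]

theorem extend_apply (φ : strictUpper k n →ₗ⁅k⁆ B) (M : Matrix (Fin n) (Fin n) R) :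
    extend φ R M = ∑ r : Pos n, φ (matrixUnit k r) ⊗ₜ[k] M r.1.1 r.1.2 := by
  simp [extend]

theorem lTensor_extend {R' : Type*} [CommRing R'] [Algebra k R'] (φ : strictUpper k n →ₗ⁅k⁆ B)
    (u : R →ₗ[k] R') (M : Matrix (Fin n) (Fin n) R) :
    u.lTensor B (extend φ R M) = extend φ R' (M.map u) := by
  simp [extend_apply]

theorem eq_sum_matrixUnit (X : strictUpper k n) :
    X = ∑ r : Pos n, (X : Matrix (Fin n) (Fin n) k) r.1.1 r.1.2 • matrixUnit k r := by
  apply Subtype.ext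
  have h : (X : Matrix (Fin n) (Fin n) k) ∈ band n k 1 := fun i j hij => X.2 i j (by omega)
  conv_lhs => rw [eq_sum_single h]
  rw [AddSubmonoidClass.coe_finsetSum]
  refine Finset.sum_congr rfl fun r _ => ?_
  simp [matrixUnit, Matrix.smul_single]

theorem single_eq_matrixUnit_map_smul (r : Pos n) (a : R) : Matrix.single r.1.1 r.1.2 a =
    (matrixUnit k r : Matrix (Fin n) (Fin n) k).map fun c => c • a := by
  ext i j
  simp only [matrixUnit, Matrix.map_apply, Matrix.single_apply]
  split_ifs <;> simp

theorem extend_map_smul (φ : strictUpper k n →ₗ⁅k⁆ B) (X : strictUpper k n) (a : R) :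
    extend φ R ((X : Matrix (Fin n) (Fin n) k).map fun c => c • a) = φ X ⊗ₜ[k] a := by
  conv_rhs => rw [eq_sum_matrixUnit X]
  simp [extend_apply, map_sum, TensorProduct.sum_tmul, TensorProduct.smul_tmul]

theorem extend_single (φ : strictUpper k n →ₗ⁅k⁆ B) (r : Pos n) (a : R) :
    extend φ R (Matrix.single r.1.1 r.1.2 a) = φ (matrixUnit k r) ⊗ₜ[k] a := by
  rw [single_eq_matrixUnit_map_smul (k := k), extend_map_smul]

theorem lie_map_smul_map_smul (X Y : strictUpper k n) (a b : R) :
    ⁅(X : Matrix (Fin n) (Fin n) k).map fun c => c • a,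
      (Y : Matrix (Fin n) (Fin n) k).map fun c => c • b⁆ =
    (⁅X, Y⁆ : strictUpper k n).1.map fun c => c • (a * b) := by
  rw [Ring.lie_def, map_smul_mul_map_smul, map_smul_mul_map_smul, mul_comm b a,
    LieSubalgebra.coe_bracket, Ring.lie_def]
  ext i j
  simp [sub_smul]

theorem extend_lie_single (φ : strictUpper k n →ₗ⁅k⁆ B) (r s : Pos n) (a b : R) :
    extend φ R ⁅Matrix.single r.1.1 r.1.2 a, Matrix.single s.1.1 s.1.2 b⁆ =
      ⁅extend φ R (Matrix.single r.1.1 r.1.2 a), extend φ R (Matrix.single s.1.1 s.1.2 b)⁆ := by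
  rw [extend_single, extend_single, single_eq_matrixUnit_map_smul (k := k),
    single_eq_matrixUnit_map_smul (k := k), lie_map_smul_map_smul, extend_map_smul,
    LieHom.map_lie, Ring.lie_def, Ring.lie_def, Algebra.TensorProduct.tmul_mul_tmul,
    Algebra.TensorProduct.tmul_mul_tmul, mul_comm b a, TensorProduct.sub_tmul]

theorem extend_lie (φ : strictUpper k n →ₗ⁅k⁆ B) {M N : Matrix (Fin n) (Fin n) R}
    (hM : M ∈ band n R 1) (hN : N ∈ band n R 1) :
    extend φ R ⁅M, N⁆ = ⁅extend φ R M, extend φ R N⁆ := by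
  rw [eq_sum_single hM, eq_sum_single hN]
  simp only [sum_lie_sum, map_sum, extend_lie_single]

end Extend

/-! ### Filtrations and degrees -/

section Filtration

open MvPolynomial

variable {k : Type*} [CommRing k] {B : Type*} [Ring B] [Algebra k B]

/-- A decreasing multiplicative filtration of `B` that vanishes from `d` on. -/
structure IsNilFiltration (E : ℕ → Submodule k B) (d : ℕ) : Prop where
  one_mem : 1 ∈ E 0
  mul_mem : ∀ {i j a b}, a ∈ E i → b ∈ E j → a * b ∈ E (i + j)
  antitone : Antitone E
  eq_bot : ∀ i, d ≤ i → E i = ⊥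

theorem mul_mem_of_span {s t : Set B} {N : Submodule k B} (h : ∀ x ∈ s, ∀ y ∈ t, x * y ∈ N)
    {x y : B} (hx : x ∈ Submodule.span k s) (hy : y ∈ Submodule.span k t) : x * y ∈ N := by
  have hle : Submodule.span k s * Submodule.span k t ≤ N := by
    rw [Submodule.span_mul_span, Submodule.span_le]
    rintro _ ⟨x, hx, y, hy, rfl⟩
    exact h x hx y hy
  exact hle (Submodule.mul_mem_mul hx hy)

variable {E : ℕ → Submodule k B} {d : ℕ}

section TensorFil

variable {R : Type*} [CommRing R] [Algebra k R]

/-- The filtration of `B ⊗ R` induced by one of `B`. -/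
def tensorFil (E : ℕ → Submodule k B) (R : Type*) [CommRing R] [Algebra k R] (i : ℕ) :
    Submodule k (B ⊗[k] R) :=
  Submodule.span k {x | ∃ b ∈ E i, ∃ r : R, x = b ⊗ₜ[k] r}

theorem tensorFil_mul_mem (hE : IsNilFiltration E d) {i j : ℕ} {x y : B ⊗[k] R}
    (hx : x ∈ tensorFil E R i) (hy : y ∈ tensorFil E R j) : x * y ∈ tensorFil E R (i + j) := by
  refine mul_mem_of_span ?_ hx hy
  rintro _ ⟨b, hb, r, rfl⟩ _ ⟨c, hc, s, rfl⟩
  exact Submodule.subset_span ⟨b * c, hE.mul_mem hb hc, r * s,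
    Algebra.TensorProduct.tmul_mul_tmul ..⟩

theorem tensorFil_pow_mem (hE : IsNilFiltration E d) {x : B ⊗[k] R} (hx : x ∈ tensorFil E R 1)
    (m : ℕ) : x ^ m ∈ tensorFil E R m := by
  induction m with
  | zero =>
    rw [pow_zero]
    exact Submodule.subset_span ⟨1, hE.one_mem, 1, rfl⟩
  | succ m ih => rw [pow_succ]; exact tensorFil_mul_mem hE ih hx

theorem eq_zero_of_mem_tensorFil (hE : IsNilFiltration E d) {i : ℕ} (hi : d ≤ i) {x : B ⊗[k] R}
    (hx : x ∈ tensorFil E R i) : x = 0 := by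
  have hle : tensorFil E R i ≤ ⊥ := by
    rw [tensorFil, Submodule.span_le]
    rintro _ ⟨b, hb, r, rfl⟩
    rw [hE.eq_bot i hi, Submodule.mem_bot] at hb
    simp [hb]
  simpa using hle hx

end TensorFil

section Degree

variable {σ K : Type*} [CommRing K] [Algebra k K]

/-- The elements of `B ⊗ K[σ]` of degree at most `D`. -/
noncomputable def degLE (k B : Type*) [CommRing k] [Ring B] [Algebra k B] (σ K : Type*)
    [CommRing K] [Algebra k K] (D : ℕ) : Submodule k (B ⊗[k] MvPolynomial σ K) :=
  Submodule.span k {x | ∃ (b : B) (f : MvPolynomial σ K), f.totalDegree ≤ D ∧ x = b ⊗ₜ[k] f}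

theorem tmul_mem_degLE {D : ℕ} (b : B) {f : MvPolynomial σ K} (hf : f.totalDegree ≤ D) :
    b ⊗ₜ[k] f ∈ degLE k B σ K D :=
  Submodule.subset_span ⟨b, f, hf, rfl⟩

theorem degLE_mono : Monotone (degLE k B σ K) := fun _ _ h =>
  Submodule.span_mono fun _ ⟨b, f, hf, hx⟩ => ⟨b, f, hf.trans h, hx⟩

theorem exists_mem_degLE (x : B ⊗[k] MvPolynomial σ K) : ∃ D, x ∈ degLE k B σ K D := by
  induction x with
  | zero => exact ⟨0, zero_mem _⟩
  | add x y hx hy =>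
    obtain ⟨D, hD⟩ := hx
    obtain ⟨D', hD'⟩ := hy
    exact ⟨max D D', add_mem (degLE_mono (le_max_left _ _) hD) (degLE_mono (le_max_right _ _) hD')⟩
  | tmul b f => exact ⟨f.totalDegree, tmul_mem_degLE b le_rfl⟩

theorem totalDegree_slice_le {D : ℕ} {x : B ⊗[k] MvPolynomial σ K} (hx : x ∈ degLE k B σ K D)
    (l : Module.Dual k B) : (slice l x).totalDegree ≤ D := by
  induction hx using Submodule.span_induction with
  | mem x hx =>
    obtain ⟨b, f, hf, rfl⟩ := hx
    rw [slice_tmul]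
    exact (totalDegree_smul_le _ _).trans hf
  | zero => simp
  | add x y _ _ hx hy =>
    rw [map_add]
    exact (totalDegree_add _ _).trans (max_le hx hy)
  | smul c x _ hx =>
    rw [map_smul]
    exact (totalDegree_smul_le _ _).trans hx

/-- The span of the `b ⊗ f` where `b` lies at least as deep in the filtration as the degree
of `f`. -/
noncomputable def degFil (hE : IsNilFiltration E d) (σ K : Type*) [CommRing K] [Algebra k K] :
    Subalgebra k (B ⊗[k] MvPolynomial σ K) :=
  (Submodule.span k {x | ∃ (i : ℕ), ∃ b ∈ E i, ∃ f : MvPolynomial σ K, f.totalDegree ≤ i ∧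
    x = b ⊗ₜ[k] f}).toSubalgebra (Submodule.subset_span ⟨0, 1, hE.one_mem, 1, by simp, rfl⟩)
    fun x y hx hy => by
      refine mul_mem_of_span ?_ hx hy
      rintro _ ⟨i, b, hb, f, hf, rfl⟩ _ ⟨j, c, hc, g, hg, rfl⟩
      exact Submodule.subset_span ⟨i + j, b * c, hE.mul_mem hb hc, f * g,
        (totalDegree_mul f g).trans (add_le_add hf hg), Algebra.TensorProduct.tmul_mul_tmul ..⟩

theorem tmul_mem_degFil (hE : IsNilFiltration E d) {i : ℕ} {b : B} (hb : b ∈ E i)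
    {f : MvPolynomial σ K} (hf : f.totalDegree ≤ i) : b ⊗ₜ[k] f ∈ degFil hE σ K :=
  Submodule.subset_span ⟨i, b, hb, f, hf, rfl⟩

theorem degFil_le_degLE (hE : IsNilFiltration E d) :
    Subalgebra.toSubmodule (degFil hE σ K) ≤ degLE k B σ K (d - 1) := by
  refine Submodule.span_le.2 ?_
  rintro _ ⟨i, b, hb, f, hf, rfl⟩
  by_cases hi : d ≤ i
  · rw [hE.eq_bot i hi, Submodule.mem_bot] at hb
    simp [hb]
  · exact tmul_mem_degLE b (by omega)

/-- Evaluation of polynomials at the origin. -/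
noncomputable def evalZero (k : Type*) [CommRing k] (σ K : Type*) [CommRing K] [Algebra k K] :
    MvPolynomial σ K →ₐ[k] K :=
  (aeval (R := K) fun _ : σ => (0 : K)).restrictScalars k

end Degree

theorem eq_constant_of_pderiv_eq_zero {k : Type*} [Field k] {p : ℕ} [CharP k p] {B : Type*} [Ring B]
    [Algebra k B] {σ K : Type*} [CommRing K] [Algebra k K] {D : ℕ} (hD : D < p)
    {x : B ⊗[k] MvPolynomial σ K} (hx : x ∈ degLE k B σ K D)
    (h : ∀ r, ((pderiv r).restrictScalars k : Derivation k (MvPolynomial σ K)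
      (MvPolynomial σ K)).toLinearMap.lTensor B x = 0) :
    x = coeffMap B (IsScalarTower.toAlgHom k K (MvPolynomial σ K))
      (coeffMap B (evalZero k σ K) x) := by
  refine eq_of_slice_eq fun l => ?_
  have hC := eq_C_of_pderiv_eq_zero k (f := slice l x) (fun r => by
    have hr := congrArg (slice l) (h r)
    rwa [slice_lTensor, map_zero] at hr) ((totalDegree_slice_le hx l).trans_lt hD)
  rw [coeffMap_apply, coeffMap_apply, slice_lTensor, slice_lTensor]
  conv_lhs => rw [hC]
  simp [evalZero, MvPolynomial.algebraMap_eq, constantCoeff_eq]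

end Filtration

section ExpRep

open Polynomial

/-- The logarithm of a unipotent matrix. -/
noncomputable def logMatrix (k : Type*) [Field k] (p : ℕ) {n : ℕ} {R : Type*} [CommRing R]
    [Algebra k R] (g : Matrix (Fin n) (Fin n) R) : Matrix (Fin n) (Fin n) R :=
  aeval (g - 1) (logPoly k p)

variable {k : Type*} [Field k] {n : ℕ} {B : Type*} [Ring B] [Algebra k B]
  {R : Type*} [CommRing R] [Algebra k R]

/-- `e^{φ(log g)}` for a unipotent matrix `g` over `R`. -/
noncomputable def expRep (p : ℕ) (φ : strictUpper k n →ₗ⁅k⁆ B) (g : Matrix (Fin n) (Fin n) R) :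
    B ⊗[k] R :=
  aeval (extend φ R (logMatrix k p g)) (expPoly k p)

/-- `e^{-φ(log g)}` for a unipotent matrix `g` over `R`. -/
noncomputable def expRepInv (p : ℕ) (φ : strictUpper k n →ₗ⁅k⁆ B)
    (g : Matrix (Fin n) (Fin n) R) : B ⊗[k] R :=
  aeval (extend φ R (logMatrix k p g)) (expInvPoly k p)

/-- `φ` maps `ε_{ij}` to the `(j - i)`-th step of the filtration. -/
def IsAdapted (E : ℕ → Submodule k B) (φ : strictUpper k n →ₗ⁅k⁆ B) : Prop :=
  ∀ r : Pos n, φ (matrixUnit k r) ∈ E (r.1.2 - r.1.1 : ℕ)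

variable {p : ℕ} {E : ℕ → Submodule k B} {d : ℕ} {φ : strictUpper k n →ₗ⁅k⁆ B}

theorem aeval_mem_subalgebra {A S : Type*} [CommSemiring A] [Semiring S] [Algebra A S]
    {T : Subalgebra A S} {x : S} (hx : x ∈ T) (q : A[X]) : aeval x q ∈ T :=
  Algebra.adjoin_le (Set.singleton_subset_iff.2 hx) (aeval_mem_adjoin_singleton A x)

theorem logMatrix_mem_band {g : Matrix (Fin n) (Fin n) R} (hg : g - 1 ∈ band n R 1) :
    logMatrix k p g ∈ band n R 1 := by
  rw [logMatrix, aeval_logPoly]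
  refine sum_mem fun j hj => ?_
  rw [← algebraMap_smul R]
  exact Submodule.smul_mem _ _ (band_antitone (Finset.mem_Icc.1 hj).1 (pow_mem_band hg j))

theorem logMatrix_one : logMatrix k p (1 : Matrix (Fin n) (Fin n) R) = 0 := by
  rw [logMatrix, sub_self, ← coeff_zero_eq_aeval_zero', coeff_zero_logPoly, map_zero]

theorem logMatrix_map {R' : Type*} [CommRing R'] [Algebra k R'] (u : R →ₐ[k] R')
    (g : Matrix (Fin n) (Fin n) R) : (logMatrix k p g).map u = logMatrix k p (g.map u) := by
  rw [logMatrix, logMatrix, ← AlgHom.mapMatrix_apply, ← AlgHom.mapMatrix_apply,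
    ← aeval_algHom_apply, map_sub, map_one]

theorem extend_mem_tensorFil (hE : IsNilFiltration E d) (hφ : IsAdapted E φ)
    (M : Matrix (Fin n) (Fin n) R) : extend φ R M ∈ tensorFil E R 1 := by
  rw [extend_apply]
  refine sum_mem fun r _ => Submodule.subset_span ⟨_, hE.antitone ?_ (hφ r), _, rfl⟩
  have := r.2
  omega

theorem extend_pow_eq_zero (hE : IsNilFiltration E d) (hφ : IsAdapted E φ) (hd : d ≤ p)
    (M : Matrix (Fin n) (Fin n) R) : extend φ R M ^ p = 0 :=
  eq_zero_of_mem_tensorFil hE hd (tensorFil_pow_mem hE (extend_mem_tensorFil hE hφ M) p)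

theorem extend_pow_mul_extend_mul_extend_pow_eq_zero (hE : IsNilFiltration E d)
    (hφ : IsAdapted E φ) (M N : Matrix (Fin n) (Fin n) R) {a b : ℕ} (hab : d ≤ a + 1 + b) :
    extend φ R M ^ a * extend φ R N * extend φ R M ^ b = 0 :=
  have hpow := tensorFil_pow_mem hE (extend_mem_tensorFil hE hφ M)
  eq_zero_of_mem_tensorFil hE hab (tensorFil_mul_mem hE
    (tensorFil_mul_mem hE (hpow a) (extend_mem_tensorFil hE hφ N)) (hpow b))

theorem coeffMap_expRep {R' : Type*} [CommRing R'] [Algebra k R'] (u : R →ₐ[k] R')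
    (g : Matrix (Fin n) (Fin n) R) : coeffMap B u (expRep p φ g) = expRep p φ (g.map u) := by
  rw [expRep, ← aeval_algHom_apply, expRep, ← logMatrix_map, coeffMap_apply, lTensor_extend]
  rfl

theorem mapMatrix_derivation_mul (D : Derivation k R R) (M N : Matrix (Fin n) (Fin n) R) :
    (D : R →ₗ[k] R).mapMatrix (M * N) =
      (D : R →ₗ[k] R).mapMatrix M * N + M * (D : R →ₗ[k] R).mapMatrix N := by
  ext i j
  simp only [LinearMap.mapMatrix_apply, Matrix.map_apply, Matrix.mul_apply, Matrix.add_apply,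
    map_sum, ← Finset.sum_add_distrib]
  refine Finset.sum_congr rfl fun l _ => ?_
  simp only [Derivation.coeFn_coe, Derivation.leibniz, smul_eq_mul]
  ring

theorem derivation_mul_inverse_eq_zero {S : Type*} [Ring S] [Algebra k S] {D : S →ₗ[k] S}
    (hD : ∀ a b, D (a * b) = D a * b + a * D b) {x y y' c : S} (hyy' : y * y' = 1)
    (hy'y : y' * y = 1) (hx : D x = x * c) (hy : D y = y * c) : D (x * y') = 0 := by
  have hone : D 1 = 0 := by simpa using hD 1 1
  have hDy' : y * D y' = -(y * c * y') := by
    have h := hD y y'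
    rw [hyy', hone, hy] at h
    exact (neg_eq_of_add_eq_zero_right h.symm).symm
  have hDy' : D y' = -(c * y') := by
    rw [← one_mul (D y'), ← hy'y, mul_assoc, hDy', mul_neg, ← mul_assoc, ← mul_assoc, hy'y, one_mul]
  rw [hD, hx, hDy']
  noncomm_ring

variable [hp : Fact p.Prime]

theorem expRep_mul_expRepInv (hE : IsNilFiltration E d) (hφ : IsAdapted E φ) (hd : d ≤ p)
    (g : Matrix (Fin n) (Fin n) R) : expRep p φ g * expRepInv p φ g = 1 :=
  aeval_expPoly_mul_aeval_expInvPoly (extend_pow_eq_zero hE hφ hd _)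

theorem expRepInv_mul_expRep (hE : IsNilFiltration E d) (hφ : IsAdapted E φ) (hd : d ≤ p)
    (g : Matrix (Fin n) (Fin n) R) : expRepInv p φ g * expRep p φ g = 1 :=
  aeval_expInvPoly_mul_aeval_expPoly (extend_pow_eq_zero hE hφ hd _)

theorem expRep_one : expRep p φ (1 : Matrix (Fin n) (Fin n) R) = 1 := by
  rw [expRep, logMatrix_one, map_zero, ← coeff_zero_eq_aeval_zero', coeff_zero_expPoly, map_one]

variable [CharP k p]

theorem aeval_logMatrix_expPoly (hn : n ≤ p) {g : Matrix (Fin n) (Fin n) R}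
    (hg : g - 1 ∈ band n R 1) : aeval (logMatrix k p g) (expPoly k p) = g := by
  rw [logMatrix, aeval_aeval_logPoly_expPoly (eq_zero_of_mem_band hn (pow_mem_band hg p)),
    add_sub_cancel]

theorem eq_dexp_of_map_derivation_eq_mul (hn : n ≤ p) (D : Derivation k R R)
    {g M : Matrix (Fin n) (Fin n) R} (hg : g - 1 ∈ band n R 1) (hM : g.map D = g * M) :
    M = dexp k p (logMatrix k p g) ((D : R →ₗ[k] R).mapMatrix (logMatrix k p g)) := by
  have hp0 := hp.out.pos
  have hZ : logMatrix k p g ∈ band n R 1 := logMatrix_mem_band hg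
  have hDZ := map_mem_band hZ (map_zero D)
  have hDg := map_aeval_expPoly (p := p) (mapMatrix_derivation_mul D) (Z := logMatrix k p g)
    fun a b hab => eq_zero_of_mem_band (by omega)
      (mul_mem_band (mul_mem_band (pow_mem_band hZ a) hDZ) (pow_mem_band hZ b))
  rw [aeval_logMatrix_expPoly hn hg] at hDg
  obtain ⟨g', -, -, hg'⟩ := exists_inverse hg
  exact (IsUnit.of_mul_eq_one_right g' hg').mul_left_cancel (hM.symm.trans hDg)

theorem lTensor_derivation_expRep (hE : IsNilFiltration E d) (hφ : IsAdapted E φ) (hd : d ≤ p)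
    (hn : n ≤ p) (D : Derivation k R R) {g M : Matrix (Fin n) (Fin n) R}
    (hg : g - 1 ∈ band n R 1) (hM : g.map D = g * M) :
    (D : R →ₗ[k] R).lTensor B (expRep p φ g) = expRep p φ g * extend φ R M := by
  have hp0 := hp.out.pos
  set Z := logMatrix k p g with hZdef
  have hZ : Z ∈ band n R 1 := logMatrix_mem_band hg
  have hDZ : (D : R →ₗ[k] R).mapMatrix Z ∈ band n R 1 := map_mem_band hZ (map_zero D)
  have hφM : extend φ R M = dexp k p (extend φ R Z) ((D : R →ₗ[k] R).lTensor B (extend φ R Z)) := by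
    rw [eq_dexp_of_map_derivation_eq_mul hn D hg hM, lTensor_extend, ← hZdef]
    exact map_dexp (L := (band n R 1).restrictScalars k)
      (fun Y hY => band_antitone one_le_two (lie_mem_band hZ hY))
      (fun Y hY => extend_lie φ hZ hY) hDZ
  rw [hφM, expRep]
  refine map_aeval_expPoly (lTensor_derivation_mul D) fun a b hab => ?_
  rw [lTensor_extend]
  exact extend_pow_mul_extend_mul_extend_pow_eq_zero hE hφ _ _ (by omega)

end ExpRep

/-! ### Multiplicativity of `e^{φ(log g)}` -/

section Multiplicativity

open MvPolynomial

variable {n : ℕ}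

/-- The generic unipotent matrix over `K`. -/
noncomputable def genericMatrix (K : Type*) [CommRing K] (n : ℕ) :
    Matrix (Fin n) (Fin n) (MvPolynomial (Pos n) K) :=
  Matrix.of fun i j => if h : i < j then X ⟨(i, j), h⟩ else if i = j then 1 else 0

section Generic

variable {K : Type*} [CommRing K]

theorem genericMatrix_apply (r : Pos n) : genericMatrix K n r.1.1 r.1.2 = X r := by
  simp [genericMatrix, r.2]

theorem genericMatrix_sub_one_mem : genericMatrix K n - 1 ∈ band n _ 1 := by
  intro i j hij
  have h : ¬ i < j := by omega
  by_cases h' : i = j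
  · subst h'; simp [genericMatrix]
  · simp [genericMatrix, h, h']

theorem genericMatrix_map {R : Type*} [CommRing R] {F : Type*}
    [FunLike F (MvPolynomial (Pos n) K) R] [RingHomClass F (MvPolynomial (Pos n) K) R] (u : F)
    {h : Matrix (Fin n) (Fin n) R} (hh : h - 1 ∈ band n R 1)
    (hu : ∀ r : Pos n, u (X r) = h r.1.1 r.1.2) : (genericMatrix K n).map u = h := by
  ext i j
  rw [Matrix.map_apply, genericMatrix, Matrix.of_apply]
  split_ifs with h1 h2
  · exact hu _
  · subst h2
    have := hh i i (by omega)
    rw [Matrix.sub_apply, Matrix.one_apply_eq, sub_eq_zero] at this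
    rw [map_one, this]
  · have := hh i j (by omega)
    rw [Matrix.sub_apply, Matrix.one_apply_ne h2, sub_zero] at this
    rw [map_zero, this]

theorem genericMatrix_map_derivation {R₀ : Type*} [CommRing R₀]
    [Algebra R₀ (MvPolynomial (Pos n) K)]
    (D : Derivation R₀ (MvPolynomial (Pos n) K) (MvPolynomial (Pos n) K))
    {N : Matrix (Fin n) (Fin n) (MvPolynomial (Pos n) K)} (hN : N ∈ band n _ 1)
    (hD : ∀ r : Pos n, D (X r) = N r.1.1 r.1.2) : (genericMatrix K n).map D = N := by
  ext1 i j
  rw [Matrix.map_apply, genericMatrix, Matrix.of_apply]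
  split_ifs with h1 h2
  · exact hD _
  · rw [Derivation.map_one_eq_zero, hN i j (by omega)]
  · rw [map_zero, hN i j (by omega)]

end Generic

section DegBand

variable {k : Type*} [CommRing k] {K : Type*} [CommRing K] [Algebra k K]

/-- Upper triangular matrices over `K[σ]` whose `(i, j)` entry has degree at most `j - i`. -/
noncomputable def degBand (k : Type*) [CommRing k] (n : ℕ) (σ K : Type*) [CommRing K]
    [Algebra k K] : Subalgebra k (Matrix (Fin n) (Fin n) (MvPolynomial σ K)) where
  carrier := {M | M ∈ band n _ 0 ∧ ∀ i j : Fin n, (M i j).totalDegree ≤ j - i}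
  mul_mem' := by
    rintro M N ⟨hM, hM'⟩ ⟨hN, hN'⟩
    refine ⟨mul_mem_band hM hN, fun i j => ?_⟩
    rw [Matrix.mul_apply]
    refine totalDegree_finsetSum_le fun l _ => ?_
    by_cases h1 : (l : ℕ) < i
    · rw [hM i l (by omega), zero_mul, totalDegree_zero]; omega
    by_cases h2 : (j : ℕ) < l
    · rw [hN l j (by omega), mul_zero, totalDegree_zero]; omega
    refine (totalDegree_mul _ _).trans ((add_le_add (hM' i l) (hN' l j)).trans ?_)
    omega
  add_mem' := by
    rintro M N ⟨hM, hM'⟩ ⟨hN, hN'⟩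
    exact ⟨add_mem hM hN, fun i j => (totalDegree_add _ _).trans (max_le (hM' i j) (hN' i j))⟩
  algebraMap_mem' := by
    intro c
    refine ⟨?_, fun i j => ?_⟩
    · rw [Algebra.algebraMap_eq_smul_one, ← algebraMap_smul (MvPolynomial σ K)]
      exact Submodule.smul_mem _ _ one_mem_band
    · rw [Matrix.algebraMap_matrix_apply]
      split_ifs
      · rw [IsScalarTower.algebraMap_apply k K, MvPolynomial.algebraMap_eq, totalDegree_C]
        omega
      · rw [totalDegree_zero]
        omega

theorem genericMatrix_mem_degBand : genericMatrix K n ∈ degBand k n (Pos n) K := by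
  refine ⟨?_, fun i j => ?_⟩
  · rw [← sub_add_cancel (genericMatrix K n) 1]
    exact add_mem (band_antitone (by omega) genericMatrix_sub_one_mem) one_mem_band
  · rw [genericMatrix, Matrix.of_apply]
    split_ifs with h1 h2
    · refine (totalDegree_monomial_le _ _).trans ?_
      simp
      omega
    · simp
    · simp

theorem map_C_mem_degBand {σ : Type*} {g : Matrix (Fin n) (Fin n) K} (hg : g ∈ band n K 0) :
    g.map (C : K → MvPolynomial σ K) ∈ degBand k n σ K :=
  ⟨map_mem_band hg (map_zero _), fun i j => by simp⟩

end DegBand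

variable {k : Type*} [Field k] {B : Type*} [Ring B] [Algebra k B] {K : Type*} [CommRing K]
  [Algebra k K] {p : ℕ} {E : ℕ → Submodule k B} {d : ℕ} {φ : strictUpper k n →ₗ⁅k⁆ B}

theorem extend_log_mem_degFil (hE : IsNilFiltration E d) (hφ : IsAdapted E φ) {σ : Type*}
    {g : Matrix (Fin n) (Fin n) (MvPolynomial σ K)} (hg : g ∈ degBand k n σ K) :
    extend φ _ (logMatrix k p g) ∈ degFil hE σ K := by
  have hlog : logMatrix k p g ∈ degBand k n σ K :=
    aeval_mem_subalgebra (sub_mem hg (one_mem _)) _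
  rw [extend_apply]
  exact sum_mem fun r _ => tmul_mem_degFil hE (hφ r) (hlog.2 _ _)

theorem expRep_mem_degFil (hE : IsNilFiltration E d) (hφ : IsAdapted E φ) {σ : Type*}
    {g : Matrix (Fin n) (Fin n) (MvPolynomial σ K)} (hg : g ∈ degBand k n σ K) :
    expRep p φ g ∈ degFil hE σ K :=
  aeval_mem_subalgebra (extend_log_mem_degFil hE hφ hg) _

theorem expRepInv_mem_degFil (hE : IsNilFiltration E d) (hφ : IsAdapted E φ) {σ : Type*}
    {g : Matrix (Fin n) (Fin n) (MvPolynomial σ K)} (hg : g ∈ degBand k n σ K) :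
    expRepInv p φ g ∈ degFil hE σ K :=
  aeval_mem_subalgebra (extend_log_mem_degFil hE hφ hg) _

theorem expRep_mul_mul_expRepInv_mem_degLE (hE : IsNilFiltration E d) (hφ : IsAdapted E φ)
    {σ : Type*} {g h : Matrix (Fin n) (Fin n) (MvPolynomial σ K)} (hg : g ∈ degBand k n σ K)
    (hh : h ∈ degBand k n σ K) : expRep p φ (g * h) * expRepInv p φ h ∈ degLE k B σ K (d - 1) :=
  degFil_le_degLE hE <| (degFil hE σ K).mul_mem (expRep_mem_degFil hE hφ (mul_mem hg hh))
    (expRepInv_mem_degFil hE hφ hh)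

theorem map_evalZero_genericMatrix :
    (genericMatrix K n).map (evalZero k (Pos n) K) = 1 :=
  genericMatrix_map _ (by simp) fun r => by
    rw [Matrix.one_apply_ne r.2.ne]
    simp [evalZero]

variable [hp : Fact p.Prime]

theorem coeffMap_evalZero_expRep_mul_mul_expRepInv (hE : IsNilFiltration E d)
    (hφ : IsAdapted E φ) (hd : d ≤ p) (g : Matrix (Fin n) (Fin n) K) :
    coeffMap B (evalZero k (Pos n) K)
      (expRep p φ (g.map C * genericMatrix K n) * expRepInv p φ (genericMatrix K n)) =
      expRep p φ g := by
  have hg : (g.map C * genericMatrix K n).map (evalZero k (Pos n) K) = g := by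
    rw [Matrix.map_mul, map_evalZero_genericMatrix, mul_one, Matrix.map_map]
    ext i j
    simp [evalZero]
  have hinv := congrArg (coeffMap B (evalZero k (Pos n) K))
    (expRep_mul_expRepInv hE hφ hd (genericMatrix K n))
  rw [map_mul, coeffMap_expRep, map_evalZero_genericMatrix, expRep_one, one_mul, map_one] at hinv
  rw [map_mul, hinv, mul_one, coeffMap_expRep, hg]

variable [CharP k p]

theorem lTensor_derivation_expRep_mul_mul_expRepInv {R : Type*} [CommRing R] [Algebra k R]
    (hE : IsNilFiltration E d) (hφ : IsAdapted E φ) (hd : d ≤ p) (hn : n ≤ p)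
    (D : Derivation k R R) {g h : Matrix (Fin n) (Fin n) R} (hg : g - 1 ∈ band n R 1)
    (hh : h - 1 ∈ band n R 1) (hDg : g.map D = 0) :
    D.toLinearMap.lTensor B (expRep p φ (g * h) * expRepInv p φ h) = 0 := by
  obtain ⟨h', -, hh', -⟩ := exists_inverse hh
  have hDh : h.map D = h * (h' * h.map D) := by rw [← mul_assoc, hh', one_mul]
  have hDgh : (g * h).map D = g * h * (h' * h.map D) := by
    rw [mul_assoc, ← hDh]
    have hleibniz := mapMatrix_derivation_mul D g h
    simp only [LinearMap.mapMatrix_apply, Derivation.coeFn_coe, hDg, zero_mul,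
      zero_add] at hleibniz
    exact hleibniz
  exact derivation_mul_inverse_eq_zero (lTensor_derivation_mul D)
    (expRep_mul_expRepInv hE hφ hd h) (expRepInv_mul_expRep hE hφ hd h)
    (lTensor_derivation_expRep hE hφ hd hn D (mul_sub_one_mem_band hg hh) hDgh)
    (lTensor_derivation_expRep hE hφ hd hn D hh hDh)

theorem expRep_mul_genericMatrix (hE : IsNilFiltration E d) (hφ : IsAdapted E φ) (hd : d ≤ p)
    (hn : n ≤ p) {g : Matrix (Fin n) (Fin n) K} (hg : g - 1 ∈ band n K 1) :
    expRep p φ (g.map C * genericMatrix K n) =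
      coeffMap B (IsScalarTower.toAlgHom k K (MvPolynomial (Pos n) K)) (expRep p φ g) *
        expRep p φ (genericMatrix K n) := by
  have hdp : d - 1 < p := by have := hp.out.pos; omega
  have hmem := expRep_mul_mul_expRepInv_mem_degLE (p := p) hE hφ
    (map_C_mem_degBand (k := k) (σ := Pos n) (mem_band_zero_of_sub_one_mem hg))
    genericMatrix_mem_degBand
  have hconst := eq_constant_of_pderiv_eq_zero hdp hmem fun r =>
    have hC : (g.map C).map
        ((pderiv r).restrictScalars k : Derivation k (MvPolynomial (Pos n) K) _) = 0 := by
      ext1 i j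
      exact pderiv_C
    lTensor_derivation_expRep_mul_mul_expRepInv hE hφ hd hn _
      (map_sub_one_mem_band hg C) genericMatrix_sub_one_mem hC
  rw [coeffMap_evalZero_expRep_mul_mul_expRepInv hE hφ hd] at hconst
  rw [← hconst, mul_assoc, expRepInv_mul_expRep hE hφ hd, mul_one]

theorem expRep_mul (hE : IsNilFiltration E d) (hφ : IsAdapted E φ) (hd : d ≤ p)
    (hn : n ≤ p) {g h : Matrix (Fin n) (Fin n) K} (hg : g - 1 ∈ band n K 1)
    (hh : h - 1 ∈ band n K 1) : expRep p φ (g * h) = expRep p φ g * expRep p φ h := by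
  let u : MvPolynomial (Pos n) K →ₐ[k] K :=
    (aeval (R := K) fun r : Pos n => h r.1.1 r.1.2).restrictScalars k
  have hu : (genericMatrix K n).map u = h := genericMatrix_map u hh fun r => by simp [u]
  have hgC : (g.map C).map u = g := by
    rw [Matrix.map_map]
    ext i j
    simp [u]
  have hgen := congrArg (coeffMap B u) (expRep_mul_genericMatrix hE hφ hd hn hg)
  have hC : g.map (IsScalarTower.toAlgHom k K (MvPolynomial (Pos n) K)) = g.map C := rfl
  rwa [map_mul, coeffMap_expRep, coeffMap_expRep, coeffMap_expRep, coeffMap_expRep, Matrix.map_mul,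
    hC, hu, hgC] at hgen

end Multiplicativity

/-! ### The Hopf algebra and its left invariant derivations -/

section Hopf

open MvPolynomial

variable {k : Type*} [Field k] {n : ℕ}

/-- `a ↦ a ⊗ 1`: functions of the first factor of `U_n × U_n`. -/
noncomputable abbrev inclLeft (k : Type*) [Field k] (n : ℕ) :
    CoordRing k n →ₐ[k] CoordRing k n ⊗[k] CoordRing k n :=
  Algebra.TensorProduct.includeLeft

/-- `a ↦ 1 ⊗ a`: functions of the second factor of `U_n × U_n`. -/
noncomputable abbrev inclRight (k : Type*) [Field k] (n : ℕ) :
    CoordRing k n →ₐ[k] CoordRing k n ⊗[k] CoordRing k n :=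
  Algebra.TensorProduct.includeRight

theorem generic_apply (r : Pos n) : generic k n r.1.1 r.1.2 = X r := genericMatrix_apply r

theorem generic_self (i : Fin n) : generic k n i i = 1 := by simp [generic]

theorem generic_eq_zero_of_lt {i j : Fin n} (h : j < i) : generic k n i j = 0 := by
  simp [generic, h.not_gt, h.ne']

theorem generic_sub_one_mem : generic k n - 1 ∈ band n _ 1 := genericMatrix_sub_one_mem

theorem comul_X (r : Pos n) : comul k n (X r) =
    ∑ l, generic k n r.1.1 l ⊗ₜ[k] generic k n l r.1.2 := by
  obtain ⟨⟨i, j⟩, hij⟩ := r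
  have hsupport : ∑ l, generic k n i l ⊗ₜ[k] generic k n l j =
      ∑ l ∈ Finset.Icc i j, generic k n i l ⊗ₜ[k] generic k n l j := by
    refine (Finset.sum_subset (Finset.subset_univ _) fun l _ hl => ?_).symm
    rw [Finset.mem_Icc, not_and_or, not_le, not_le] at hl
    rcases hl with hl | hl
    · rw [generic_eq_zero_of_lt hl, TensorProduct.zero_tmul]
    · rw [generic_eq_zero_of_lt hl, TensorProduct.tmul_zero]
  have hX : generic k n i j = X ⟨(i, j), hij⟩ := generic_apply ⟨(i, j), hij⟩
  rw [hsupport, ← Finset.Ico_insert_right hij.le, Finset.sum_insert (by simp),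
    ← Finset.Ioo_insert_left hij, Finset.sum_insert (by simp), comul, aeval_X, generic_self,
    generic_self, hX]
  abel

theorem generic_map_comul : (generic k n).map (comul k n) =
    (generic k n).map (inclLeft k n) * (generic k n).map (inclRight k n) := by
  refine genericMatrix_map _ (mul_sub_one_mem_band
    (map_sub_one_mem_band generic_sub_one_mem (inclLeft k n).toRingHom)
    (map_sub_one_mem_band generic_sub_one_mem (inclRight k n).toRingHom)) fun r => ?_
  rw [comul_X, Matrix.mul_apply]
  simp

theorem generic_map_counit : (generic k n).map (counit k n) = 1 :=
  genericMatrix_map _ (by simp) fun r => by simp [counit, Matrix.one_apply_ne r.2.ne]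

theorem counit_generic (i j : Fin n) : counit k n (generic k n i j) =
    (1 : Matrix (Fin n) (Fin n) k) i j :=
  congrFun (congrFun (generic_map_counit (k := k) (n := n)) i) j

/-- The left invariant derivation `D` of `A_n` with `D g = g X`. -/
noncomputable def invDeriv (X : Matrix (Fin n) (Fin n) k) :
    Derivation k (CoordRing k n) (CoordRing k n) :=
  mkDerivation k fun r => (generic k n * X.map (algebraMap k (CoordRing k n))) r.1.1 r.1.2

theorem invDeriv_X (X : Matrix (Fin n) (Fin n) k) (r : Pos n) :
    invDeriv X (MvPolynomial.X r) =
      (generic k n * X.map (algebraMap k (CoordRing k n))) r.1.1 r.1.2 :=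
  mkDerivation_X ..

theorem strictUpper_mem_band (X : strictUpper k n) : X.1 ∈ band n k 1 :=
  fun i j hij => X.2 i j (by omega)

theorem generic_map_invDeriv (X : strictUpper k n) : (generic k n).map (invDeriv X.1) =
    generic k n * X.1.map (algebraMap k (CoordRing k n)) := by
  have hmem := mul_mem_band (mem_band_zero_of_sub_one_mem generic_sub_one_mem)
    (map_mem_band (strictUpper_mem_band X) (map_zero (algebraMap k (CoordRing k n))))
  rw [zero_add] at hmem
  exact genericMatrix_map_derivation (invDeriv X.1) hmem (invDeriv_X X.1)

theorem counit_invDeriv_generic (X : strictUpper k n) (i j : Fin n) :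
    counit k n (invDeriv X.1 (generic k n i j)) = X.1 i j := by
  have h := congrArg (fun M => M.map (counit k n)) (generic_map_invDeriv X)
  simp only [Matrix.map_mul, generic_map_counit, one_mul, Matrix.map_map] at h
  simpa using congrFun (congrFun h i) j

theorem mul_map_invDeriv (X : strictUpper k n) (Y : Matrix (Fin n) (Fin n) k) :
    (generic k n * Y.map (algebraMap k (CoordRing k n))).map (invDeriv X.1) =
      generic k n * (X.1 * Y).map (algebraMap k (CoordRing k n)) := by
  have hconst : (invDeriv X.1 : CoordRing k n →ₗ[k] CoordRing k n).mapMatrix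
      (Y.map (algebraMap k (CoordRing k n))) = 0 := by
    ext1 i j
    simp
  have hleibniz := mapMatrix_derivation_mul (invDeriv X.1) (generic k n)
    (Y.map (algebraMap k (CoordRing k n)))
  rw [hconst, mul_zero, add_zero] at hleibniz
  refine hleibniz.trans ?_
  rw [Matrix.map_mul, ← mul_assoc, ← generic_map_invDeriv]
  rfl

theorem invDeriv_add (X Y : Matrix (Fin n) (Fin n) k) :
    invDeriv (X + Y) = invDeriv X + invDeriv Y := by
  refine derivation_ext fun r => ?_
  simp [invDeriv, Matrix.map_add, mul_add]

theorem invDeriv_smul (c : k) (X : Matrix (Fin n) (Fin n) k) :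
    invDeriv (c • X) = c • invDeriv X := by
  refine derivation_ext fun r => ?_
  have hsmul : (c • X).map (algebraMap k (CoordRing k n)) =
      c • X.map (algebraMap k (CoordRing k n)) := by
    ext1 i j
    rw [Matrix.map_apply, Matrix.smul_apply, Matrix.smul_apply, smul_eq_mul, map_mul,
      ← Algebra.smul_def, Matrix.map_apply]
  rw [Derivation.smul_apply, invDeriv_X, invDeriv_X, hsmul, mul_smul_comm, Matrix.smul_apply]

theorem invDeriv_lie (X Y : strictUpper k n) :
    invDeriv (⁅X, Y⁆ : strictUpper k n).1 = ⁅invDeriv X.1, invDeriv Y.1⁆ := by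
  refine derivation_ext fun r => ?_
  have hcomp : ∀ Z Z' : strictUpper k n, invDeriv Z.1 (invDeriv Z'.1 (MvPolynomial.X r)) =
      (generic k n * (Z.1 * Z'.1).map (algebraMap k (CoordRing k n))) r.1.1 r.1.2 := by
    intro Z Z'
    rw [invDeriv_X, ← mul_map_invDeriv]
    rfl
  rw [Derivation.commutator_apply, invDeriv_X, hcomp, hcomp, ← Matrix.sub_apply, ← mul_sub,
    ← Matrix.map_sub _ (map_sub _)]
  rfl

theorem invDeriv_pow_X (X : strictUpper k n) (m : ℕ) (r : Pos n) :
    ((invDeriv X.1 : Module.End k (CoordRing k n)) ^ (m + 1)) (MvPolynomial.X r) =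
      (generic k n * (X.1 ^ (m + 1)).map (algebraMap k (CoordRing k n))) r.1.1 r.1.2 := by
  induction m generalizing r with
  | zero => rw [zero_add, pow_one, pow_one]; exact invDeriv_X ..
  | succ m ih =>
    rw [pow_succ', Module.End.mul_apply, ih, pow_succ' X.1 (m + 1), ← mul_map_invDeriv]
    rfl

section PowChar

variable {k : Type*} [CommRing k] {R : Type*} [CommRing R] [Algebra k R]

theorem derivation_pow_mul' (D : Derivation k R R) (m : ℕ) (x : R ⊗[k] R) :
    ((D : Module.End k R) ^ m) (LinearMap.mul' k R x) = LinearMap.mul' k R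
      ((((D : Module.End k R).rTensor R + (D : Module.End k R).lTensor R :
        Module.End k (R ⊗[k] R)) ^ m) x) := by
  have hleibniz : ∀ x, D (LinearMap.mul' k R x) = LinearMap.mul' k R
      (((D : Module.End k R).rTensor R + (D : Module.End k R).lTensor R) x) := by
    intro x
    induction x with
    | zero => simp
    | add x y hx hy => simp only [map_add, hx, hy]
    | tmul a b => simp [mul_comm, add_comm]
  induction m generalizing x with
  | zero => simp
  | succ m ih =>
    rw [pow_succ, Module.End.mul_apply, Derivation.coeFn_coe, hleibniz, ih, pow_succ,
      Module.End.mul_apply]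

theorem derivation_pow_char_mul (p : ℕ) [hp : Fact p.Prime] [CharP k p] (D : Derivation k R R)
    (a b : R) : ((D : Module.End k R) ^ p) (a * b) =
      ((D : Module.End k R) ^ p) a * b + a * ((D : Module.End k R) ^ p) b := by
  set d : Module.End k R := (D : Module.End k R)
  let dl : Module.End k (R ⊗[k] R) := d.rTensor R
  let dr : Module.End k (R ⊗[k] R) := d.lTensor R
  have hcomm : Commute dl dr := by
    change dl ∘ₗ dr = dr ∘ₗ dl
    rw [LinearMap.rTensor_comp_lTensor, LinearMap.lTensor_comp_rTensor]
  have hp0 : (p : Module.End k (R ⊗[k] R)) = 0 := by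
    rw [← map_natCast (algebraMap k (Module.End k (R ⊗[k] R))), CharP.cast_eq_zero, map_zero]
  have hadd : (dl + dr) ^ p = (d ^ p).rTensor R + (d ^ p).lTensor R := by
    obtain ⟨r, hr⟩ := hcomm.exists_add_pow_prime_eq hp.out
    rw [hr, hp0, zero_mul, zero_mul, zero_mul, add_zero, LinearMap.rTensor_pow,
      LinearMap.lTensor_pow]
  have hleibniz := derivation_pow_mul' D p (a ⊗ₜ b)
  rw [hadd] at hleibniz
  simpa using hleibniz

end PowChar

variable {p : ℕ} [hp : Fact p.Prime]

theorem counit_expand (a : CoordRing k n) : counit k n (expand p a) = counit k n a := by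
  suffices h : (counit k n).comp (expand p) = counit k n from DFunLike.congr_fun h a
  refine algHom_ext fun r => ?_
  simp [counit, hp.out.ne_zero]

theorem expand_generic (i j : Fin n) : expand p (generic k n i j) = generic k n i j ^ p := by
  rw [generic, Matrix.of_apply]
  split_ifs
  · simp
  · simp
  · simp [hp.out.ne_zero]

variable [CharP k p]

theorem comul_expand (a : CoordRing k n) : comul k n (expand p a) =
    Algebra.TensorProduct.map (expand p) (expand p) (comul k n a) := by
  have hchar : CharP (CoordRing k n ⊗[k] CoordRing k n) p :=
    charP_of_injective_algebraMap (algebraMap k _).injective p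
  suffices h : (comul k n).comp (expand p) =
      (Algebra.TensorProduct.map (expand p) (expand p)).comp (comul k n) from
    DFunLike.congr_fun h a
  refine algHom_ext fun r => ?_
  rw [AlgHom.comp_apply, AlgHom.comp_apply, expand_X, map_pow, comul_X, sum_pow_char, map_sum]
  refine Finset.sum_congr rfl fun l _ => ?_
  rw [Algebra.TensorProduct.tmul_pow, Algebra.TensorProduct.map_tmul, expand_generic,
    expand_generic]

theorem invDeriv_pow_char (hn : n ≤ p) (X : strictUpper k n) :
    (invDeriv X.1 : Module.End k (CoordRing k n)) ^ p = 0 := by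
  obtain ⟨q, rfl⟩ : ∃ q, p = q + 1 := Nat.exists_eq_succ_of_ne_zero hp.out.ne_zero
  refine LinearMap.ext fun f => ?_
  induction f using MvPolynomial.induction_on with
  | C c =>
    rw [pow_succ, Module.End.mul_apply]
    simp
  | add f g hf hg => rw [map_add, hf, hg]; simp
  | mul_X f r hf =>
    have hX : X.1 ^ (q + 1) = 0 := eq_zero_of_mem_band hn
      (pow_mem_band (strictUpper_mem_band X) (q + 1))
    rw [derivation_pow_char_mul, hf, invDeriv_pow_X, hX]
    simp

end Hopf

/-! ### Representations and their differentials -/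

section TensorDerivation

variable {k : Type*} [CommRing k] {B : Type*} [Ring B] [Algebra k B]
  {R S : Type*} [CommRing R] [Algebra k R] [CommRing S] [Algebra k S]

/-- The derivation `1 ⊗ D` of `S ⊗ R`. -/
noncomputable def derivRight (S : Type*) [CommRing S] [Algebra k S] (D : Derivation k R R) :
    Derivation k (S ⊗[k] R) (S ⊗[k] R) :=
  Derivation.mk' (D.toLinearMap.lTensor S) fun a b => by
    rw [lTensor_derivation_mul, smul_eq_mul, smul_eq_mul, add_comm, mul_comm b]

@[simp]
theorem derivRight_tmul (D : Derivation k R R) (s : S) (r : R) :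
    derivRight S D (s ⊗ₜ[k] r) = s ⊗ₜ[k] D r := rfl

/-- The derivation `D ⊗ 1` of `S ⊗ R`. -/
noncomputable def derivLeft (R : Type*) [CommRing R] [Algebra k R] (D : Derivation k S S) :
    Derivation k (S ⊗[k] R) (S ⊗[k] R) :=
  Derivation.mk' (D.toLinearMap.rTensor R) fun x y => by
    induction x with
    | zero => simp
    | add x x' hx hx' => simp only [add_mul, map_add, hx, hx', add_smul, smul_add]; abel
    | tmul b r =>
      induction y with
      | zero => simp
      | add y y' hy hy' => simp only [mul_add, map_add, hy, hy', add_smul, smul_add]; abel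
      | tmul c s =>
        simp only [Algebra.TensorProduct.tmul_mul_tmul, LinearMap.rTensor_tmul,
          Derivation.coeFn_coe, Derivation.leibniz, smul_eq_mul, TensorProduct.add_tmul]
        rw [mul_comm s r]

@[simp]
theorem derivLeft_tmul (D : Derivation k S S) (s : S) (r : R) :
    derivLeft R D (s ⊗ₜ[k] r) = D s ⊗ₜ[k] r := rfl

theorem lTensor_derivRight_includeRight (D : Derivation k R R) (x : B ⊗[k] R) :
    (derivRight S D).toLinearMap.lTensor B
        (coeffMap B (Algebra.TensorProduct.includeRight : R →ₐ[k] S ⊗[k] R) x) =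
      coeffMap B Algebra.TensorProduct.includeRight (D.toLinearMap.lTensor B x) := by
  induction x with
  | zero => simp
  | add x y hx hy => simp only [map_add, hx, hy]
  | tmul b a => simp

theorem lTensor_derivRight_includeLeft (D : Derivation k R R) (x : B ⊗[k] S) :
    (derivRight S D).toLinearMap.lTensor B
      (coeffMap B (Algebra.TensorProduct.includeLeft : S →ₐ[k] S ⊗[k] R) x) = 0 := by
  induction x with
  | zero => simp
  | add x y hx hy => simp only [map_add, hx, hy, add_zero]
  | tmul b a => simp

theorem lTensor_derivLeft_includeLeft (D : Derivation k S S) (x : B ⊗[k] S) :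
    (derivLeft R D).toLinearMap.lTensor B
        (coeffMap B (Algebra.TensorProduct.includeLeft : S →ₐ[k] S ⊗[k] R) x) =
      coeffMap B Algebra.TensorProduct.includeLeft (D.toLinearMap.lTensor B x) := by
  induction x with
  | zero => simp
  | add x y hx hy => simp only [map_add, hx, hy]
  | tmul b a => simp

theorem lTensor_derivLeft_includeRight (D : Derivation k S S) (x : B ⊗[k] R) :
    (derivLeft R D).toLinearMap.lTensor B
      (coeffMap B (Algebra.TensorProduct.includeRight : R →ₐ[k] S ⊗[k] R) x) = 0 := by
  induction x with
  | zero => simp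
  | add x y hx hy => simp only [map_add, hx, hy, add_zero]
  | tmul b a => simp

theorem lTensor_derivation_mul_tmul_one (D : Derivation k R R) (x : B ⊗[k] R) (b : B) :
    D.toLinearMap.lTensor B (x * b ⊗ₜ[k] 1) = D.toLinearMap.lTensor B x * b ⊗ₜ[k] 1 := by
  rw [lTensor_derivation_mul]
  simp

end TensorDerivation

section RepElement

open MvPolynomial

variable {k : Type*} [Field k] {n : ℕ} {B : Type*} [Ring B] [Algebra k B]

/-- The value at the identity of `U_n`. -/
noncomputable def evalOne (k : Type*) [Field k] (n : ℕ) (B : Type*) [Ring B] [Algebra k B] :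
    B ⊗[k] CoordRing k n →ₐ[k] B :=
  (Algebra.TensorProduct.rid k k B).toAlgHom.comp (coeffMap B (counit k n))

@[simp]
theorem evalOne_tmul (b : B) (a : CoordRing k n) :
    evalOne k n B (b ⊗ₜ[k] a) = counit k n a • b := by
  simp [evalOne]

/-- `Θ` is the matrix formula of a representation: `Θ(gh) = Θ(g)Θ(h)` and `Θ(1) = 1`. -/
structure IsRepElement (Θ : B ⊗[k] CoordRing k n) : Prop where
  comul_eq : coeffMap B (comul k n) Θ =
    coeffMap B (inclLeft k n) Θ * coeffMap B (inclRight k n) Θ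
  evalOne_eq : evalOne k n B Θ = 1

/-- Restriction of a function on `U_n × U_n` to `U_n × 1`. -/
noncomputable def projLeft (k : Type*) [Field k] (n : ℕ) :
    CoordRing k n ⊗[k] CoordRing k n →ₐ[k] CoordRing k n :=
  Algebra.TensorProduct.productMap (AlgHom.id k _) ((Algebra.ofId k _).comp (counit k n))

/-- Restriction of a function on `U_n × U_n` to `1 × U_n`. -/
noncomputable def projRight (k : Type*) [Field k] (n : ℕ) :
    CoordRing k n ⊗[k] CoordRing k n →ₐ[k] CoordRing k n :=
  Algebra.TensorProduct.productMap ((Algebra.ofId k _).comp (counit k n)) (AlgHom.id k _)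

@[simp]
theorem projLeft_tmul (a b : CoordRing k n) :
    projLeft k n (a ⊗ₜ[k] b) = counit k n b • a := by
  simp only [projLeft, Algebra.TensorProduct.productMap_apply_tmul, AlgHom.coe_id, id_eq,
    AlgHom.comp_apply, Algebra.ofId_apply]
  rw [mul_comm, ← Algebra.smul_def]

@[simp]
theorem projRight_tmul (a b : CoordRing k n) :
    projRight k n (a ⊗ₜ[k] b) = counit k n a • b := by
  simp only [projRight, Algebra.TensorProduct.productMap_apply_tmul, AlgHom.coe_id, id_eq,
    AlgHom.comp_apply, Algebra.ofId_apply]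
  rw [← Algebra.smul_def]

theorem projLeft_comul (a : CoordRing k n) : projLeft k n (comul k n a) = a := by
  suffices h : (projLeft k n).comp (comul k n) = AlgHom.id k _ from DFunLike.congr_fun h a
  refine algHom_ext fun r => ?_
  rw [AlgHom.comp_apply, comul_X, map_sum]
  simp only [projLeft_tmul, counit_generic, Matrix.one_apply, ite_smul, one_smul, zero_smul]
  simp [generic_apply]

theorem projRight_comul (a : CoordRing k n) : projRight k n (comul k n a) = a := by
  suffices h : (projRight k n).comp (comul k n) = AlgHom.id k _ from DFunLike.congr_fun h a
  refine algHom_ext fun r => ?_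
  rw [AlgHom.comp_apply, comul_X, map_sum]
  simp only [projRight_tmul, counit_generic, Matrix.one_apply, ite_smul, one_smul, zero_smul]
  simp [generic_apply]

theorem projLeft_inclLeft (Θ : B ⊗[k] CoordRing k n) :
    coeffMap B (projLeft k n) (coeffMap B (inclLeft k n) Θ) = Θ := by
  induction Θ with
  | zero => simp
  | add x y hx hy => simp only [map_add, hx, hy]
  | tmul b a => simp

theorem projRight_inclRight (Θ : B ⊗[k] CoordRing k n) :
    coeffMap B (projRight k n) (coeffMap B (inclRight k n) Θ) = Θ := by
  induction Θ with
  | zero => simp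
  | add x y hx hy => simp only [map_add, hx, hy]
  | tmul b a => simp

theorem projLeft_inclRight (Θ : B ⊗[k] CoordRing k n) :
    coeffMap B (projLeft k n) (coeffMap B (inclRight k n) Θ) = evalOne k n B Θ ⊗ₜ[k] 1 := by
  induction Θ with
  | zero => simp
  | add x y hx hy => simp only [map_add, hx, hy, TensorProduct.add_tmul]
  | tmul b a => simp [TensorProduct.smul_tmul]

theorem projRight_inclLeft (Θ : B ⊗[k] CoordRing k n) :
    coeffMap B (projRight k n) (coeffMap B (inclLeft k n) Θ) = evalOne k n B Θ ⊗ₜ[k] 1 := by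
  induction Θ with
  | zero => simp
  | add x y hx hy => simp only [map_add, hx, hy, TensorProduct.add_tmul]
  | tmul b a => simp [TensorProduct.smul_tmul]

theorem invDeriv_eq_projLeft (X : strictUpper k n) (a : CoordRing k n) :
    invDeriv X.1 a = projLeft k n (derivRight _ (invDeriv X.1) (comul k n a)) := by
  let D : Derivation k (CoordRing k n) (CoordRing k n) :=
    Derivation.mk' ((projLeft k n).toLinearMap ∘ₗ
      (derivRight _ (invDeriv X.1)).toLinearMap ∘ₗ (comul k n).toLinearMap) fun a b => by
      simp [projLeft_comul]
  suffices h : invDeriv X.1 = D from DFunLike.congr_fun h a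
  refine derivation_ext fun r => ?_
  change _ = projLeft k n (derivRight _ (invDeriv X.1) (comul k n _))
  rw [comul_X, map_sum, map_sum]
  simp only [derivRight_tmul, projLeft_tmul, counit_invDeriv_generic]
  rw [invDeriv_X, Matrix.mul_apply]
  refine Finset.sum_congr rfl fun l _ => ?_
  rw [Matrix.map_apply, mul_comm, ← Algebra.smul_def]

/-- The value at `X` of the differential of `Θ` at the identity of `U_n`. -/
noncomputable def differential (Θ : B ⊗[k] CoordRing k n) (X : strictUpper k n) : B :=
  evalOne k n B ((invDeriv X.1).toLinearMap.lTensor B Θ)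

variable {Θ : B ⊗[k] CoordRing k n}

theorem lTensor_invDeriv (hΘ : IsRepElement Θ) (X : strictUpper k n) :
    (invDeriv X.1).toLinearMap.lTensor B Θ = Θ * differential Θ X ⊗ₜ[k] 1 := by
  have hcomul : (invDeriv X.1).toLinearMap.lTensor B Θ = coeffMap B (projLeft k n)
      ((derivRight _ (invDeriv X.1)).toLinearMap.lTensor B (coeffMap B (comul k n) Θ)) := by
    rw [coeffMap_apply, coeffMap_apply, ← LinearMap.lTensor_comp_apply,
      ← LinearMap.lTensor_comp_apply]
    exact congrArg (fun f => LinearMap.lTensor B f Θ) (LinearMap.ext (invDeriv_eq_projLeft X))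
  rw [hcomul, hΘ.comul_eq, lTensor_derivation_mul, lTensor_derivRight_includeLeft, zero_mul,
    zero_add, lTensor_derivRight_includeRight, map_mul, projLeft_inclLeft, projLeft_inclRight]
  rfl

theorem lTensor_invDeriv_comp (hΘ : IsRepElement Θ) (X Y : strictUpper k n) :
    ((invDeriv X.1).toLinearMap ∘ₗ (invDeriv Y.1).toLinearMap).lTensor B Θ =
      Θ * (differential Θ X * differential Θ Y) ⊗ₜ[k] 1 := by
  rw [LinearMap.lTensor_comp_apply, lTensor_invDeriv hΘ Y, lTensor_derivation_mul_tmul_one,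
    lTensor_invDeriv hΘ X, mul_assoc, Algebra.TensorProduct.tmul_mul_tmul, one_mul]

theorem lTensor_invDeriv_pow (hΘ : IsRepElement Θ) (X : strictUpper k n) (m : ℕ) :
    ((invDeriv X.1 : Module.End k (CoordRing k n)) ^ m).lTensor B Θ =
      Θ * (differential Θ X ^ m) ⊗ₜ[k] 1 := by
  induction m with
  | zero => simp [Module.End.one_eq_id, ← Algebra.TensorProduct.one_def]
  | succ m ih =>
    rw [pow_succ', Module.End.mul_eq_comp, LinearMap.lTensor_comp_apply, ih,
      lTensor_derivation_mul_tmul_one, lTensor_invDeriv hΘ, mul_assoc,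
      Algebra.TensorProduct.tmul_mul_tmul, one_mul, pow_succ']

theorem differential_eq_of_lTensor_eq (hΘ : evalOne k n B Θ = 1) {X : strictUpper k n} {b : B}
    (h : (invDeriv X.1).toLinearMap.lTensor B Θ = Θ * b ⊗ₜ[k] 1) : differential Θ X = b := by
  rw [differential, h, map_mul, hΘ, one_mul]
  simp

/-- The differential of a representation, as a homomorphism of Lie algebras. -/
noncomputable def differentialHom (hΘ : IsRepElement Θ) : strictUpper k n →ₗ⁅k⁆ B where
  toFun := differential Θ
  map_add' X Y := by
    have hadd : (invDeriv (X + Y).1).toLinearMap =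
        (invDeriv X.1).toLinearMap + (invDeriv Y.1).toLinearMap :=
      congrArg Derivation.toLinearMap (invDeriv_add X.1 Y.1)
    rw [differential, hadd, LinearMap.lTensor_add, LinearMap.add_apply, map_add]
    rfl
  map_smul' c X := by
    have hsmul : (invDeriv (c • X).1).toLinearMap = c • (invDeriv X.1).toLinearMap :=
      congrArg Derivation.toLinearMap (invDeriv_smul c X.1)
    rw [differential, hsmul, LinearMap.lTensor_smul, LinearMap.smul_apply, map_smul]
    rfl
  map_lie' {X Y} := by
    have hlie : (invDeriv (⁅X, Y⁆ : strictUpper k n).1).toLinearMap =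
        (invDeriv X.1).toLinearMap ∘ₗ (invDeriv Y.1).toLinearMap -
          (invDeriv Y.1).toLinearMap ∘ₗ (invDeriv X.1).toLinearMap :=
      congrArg Derivation.toLinearMap (invDeriv_lie X Y)
    refine differential_eq_of_lTensor_eq hΘ.evalOne_eq ?_
    rw [hlie, LinearMap.lTensor_sub, LinearMap.sub_apply, lTensor_invDeriv_comp hΘ,
      lTensor_invDeriv_comp hΘ, ← mul_sub, ← TensorProduct.sub_tmul, Ring.lie_def]

variable {p : ℕ} [hp : Fact p.Prime]

theorem evalOne_coeffMap_expand (Θ : B ⊗[k] CoordRing k n) :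
    evalOne k n B (coeffMap B (expand p) Θ) = evalOne k n B Θ := by
  have hcounit : (counit k n).comp (expand p) = counit k n := AlgHom.ext (counit_expand (p := p))
  rw [evalOne, AlgHom.comp_apply, AlgHom.comp_apply, coeffMap_coeffMap, hcounit]

variable [CharP k p]

theorem differential_pow_char (hn : n ≤ p) (hΘ : IsRepElement Θ) (X : strictUpper k n) :
    differential Θ X ^ p = 0 := by
  have hpow := congrArg (evalOne k n B) (lTensor_invDeriv_pow hΘ X p)
  rw [invDeriv_pow_char hn, map_mul, hΘ.evalOne_eq, one_mul] at hpow
  simpa using hpow.symm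

theorem isRepElement_coeffMap_expand : IsRepElement (coeffMap B (expand p) Θ) ↔
    IsRepElement Θ := by
  let expand₂ := Algebra.TensorProduct.map (expand p : CoordRing k n →ₐ[k] CoordRing k n)
    (expand p : CoordRing k n →ₐ[k] CoordRing k n)
  have hinj : Function.Injective (coeffMap B expand₂) := by
    have hexpand : Function.Injective (expand p : CoordRing k n →ₐ[k] CoordRing k n) :=
      expand_injective hp.out.pos
    exact coeffMap_injective (TensorProduct.map_injective_of_flat_flat (expand p).toLinearMap
      (expand p).toLinearMap hexpand hexpand)
  have hcomul : (comul k n).comp (expand p) = expand₂.comp (comul k n) :=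
    AlgHom.ext (comul_expand (p := p))
  have hleft : (inclLeft k n).comp (expand p) = expand₂.comp (inclLeft k n) :=
    AlgHom.ext fun a => by simp [expand₂]
  have hright : (inclRight k n).comp (expand p) = expand₂.comp (inclRight k n) :=
    AlgHom.ext fun a => by simp [expand₂]
  have hmul : coeffMap B (comul k n) (coeffMap B (expand p) Θ) =
      coeffMap B (inclLeft k n) (coeffMap B (expand p) Θ) *
        coeffMap B (inclRight k n) (coeffMap B (expand p) Θ) ↔
      coeffMap B (comul k n) Θ = coeffMap B (inclLeft k n) Θ * coeffMap B (inclRight k n) Θ := by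
    simp only [coeffMap_coeffMap, hcomul, hleft, hright]
    simp only [← coeffMap_coeffMap, ← map_mul, hinj.eq_iff]
  have hone := evalOne_coeffMap_expand (p := p) Θ
  exact ⟨fun h => ⟨hmul.1 h.1, hone ▸ h.2⟩, fun h => ⟨hmul.2 h.1, hone.trans h.2⟩⟩

variable {E : ℕ → Submodule k B} {d : ℕ} {φ : strictUpper k n →ₗ⁅k⁆ B}

theorem isRepElement_expRep (hE : IsNilFiltration E d) (hφ : IsAdapted E φ) (hd : d ≤ p)
    (hn : n ≤ p) : IsRepElement (expRep p φ (generic k n)) where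
  comul_eq := by
    rw [coeffMap_expRep, coeffMap_expRep, coeffMap_expRep, generic_map_comul]
    exact expRep_mul hE hφ hd hn
      (map_sub_one_mem_band generic_sub_one_mem (inclLeft k n).toRingHom)
      (map_sub_one_mem_band generic_sub_one_mem (inclRight k n).toRingHom)
  evalOne_eq := by
    rw [evalOne, AlgHom.comp_apply, coeffMap_expRep, generic_map_counit, expRep_one, map_one]

theorem lTensor_invDeriv_expRep (hE : IsNilFiltration E d) (hφ : IsAdapted E φ) (hd : d ≤ p)
    (hn : n ≤ p) (X : strictUpper k n) :
    (invDeriv X.1).toLinearMap.lTensor B (expRep p φ (generic k n)) =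
      expRep p φ (generic k n) * φ X ⊗ₜ[k] 1 := by
  have hX : X.1.map (algebraMap k (CoordRing k n)) = X.1.map (· • (1 : CoordRing k n)) := by
    ext1 i j
    rw [Matrix.map_apply, Matrix.map_apply, Algebra.algebraMap_eq_smul_one]
  rw [← extend_map_smul φ X (1 : CoordRing k n), ← hX]
  exact lTensor_derivation_expRep hE hφ hd hn (invDeriv X.1) generic_sub_one_mem
    (generic_map_invDeriv X)

theorem differential_expRep (hE : IsNilFiltration E d) (hφ : IsAdapted E φ) (hd : d ≤ p)
    (hn : n ≤ p) (X : strictUpper k n) : differential (expRep p φ (generic k n)) X = φ X :=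
  differential_eq_of_lTensor_eq (isRepElement_expRep hE hφ hd hn).evalOne_eq
    (lTensor_invDeriv_expRep hE hφ hd hn X)

end RepElement

/-! ### Adapted filtrations from Engel's theorem -/

section Engel

open Module LieModule

section LowerCentralSeries

variable {R L M : Type*} [CommRing R] [LieRing L] [LieAlgebra R L] [AddCommGroup M] [Module R M]
  [LieRingModule L M] [LieModule R L M] [LieModule.IsNilpotent L M]

theorem lowerCentralSeries_eq_bot_of_succ_eq {i : ℕ}
    (h : lowerCentralSeries R L M (i + 1) = lowerCentralSeries R L M i) :
    lowerCentralSeries R L M i = ⊥ := by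
  have hstationary : ∀ j, lowerCentralSeries R L M (i + j) = lowerCentralSeries R L M i := by
    intro j
    induction j with
    | zero => rfl
    | succ j ih =>
      rw [← add_assoc, lowerCentralSeries_succ, ih, ← lowerCentralSeries_succ, h]
  obtain ⟨N, hN⟩ := IsNilpotent.nilpotent R L M
  rw [← hstationary N, eq_bot_iff, ← hN]
  exact antitone_lowerCentralSeries R L M (Nat.le_add_left N i)

end LowerCentralSeries

section Flag

variable {k L V : Type*} [Field k] [LieRing L] [LieAlgebra k L] [AddCommGroup V] [Module k V]
  [FiniteDimensional k V]

theorem lowerCentralSeries_finrank_eq_bot [LieRingModule L V] [LieModule k L V]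
    [LieModule.IsNilpotent L V] : lowerCentralSeries k L V (finrank k V) = ⊥ := by
  let F := lowerCentralSeries k L V
  have hdrop : ∀ i, F i = ⊥ ∨ finrank k (F i) + i ≤ finrank k V := by
    intro i
    induction i with
    | zero => exact Or.inr (Submodule.finrank_le (F 0).toSubmodule)
    | succ i ih =>
      have hle : F (i + 1) ≤ F i := antitone_lowerCentralSeries k L V i.le_succ
      rcases hle.eq_or_lt with heq | hlt
      · exact Or.inl (heq.trans (lowerCentralSeries_eq_bot_of_succ_eq heq))
      · have hfinrank : finrank k (F (i + 1)) < finrank k (F i) :=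
          Submodule.finrank_lt_finrank_of_lt hlt
        rcases ih with hbot | hbound
        · exact absurd (hbot ▸ hlt) not_lt_bot
        · exact Or.inr (by omega)
  refine (hdrop (finrank k V)).elim id fun hbound => ?_
  have hzero : finrank k (F (finrank k V)) = 0 := by omega
  exact (LieSubmodule.toSubmodule_eq_bot _).1 (Submodule.finrank_eq_zero.1 hzero)

theorem exists_flag_of_isNilpotent (φ : L →ₗ⁅k⁆ End k V) (hφ : ∀ X, _root_.IsNilpotent (φ X)) :
    ∃ F : ℕ → Submodule k V, Antitone F ∧ F 0 = ⊤ ∧ F (finrank k V) = ⊥ ∧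
      ∀ X i, ∀ v ∈ F i, φ X v ∈ F (i + 1) := by
  let _ : LieRingModule L V := LieRingModule.compLieHom V φ
  have _ : LieModule k L V := LieModule.compLieHom V φ
  have _ : LieModule.IsNilpotent L V := (isNilpotent_iff_forall' (R := k)).2 hφ
  refine ⟨fun i => (lowerCentralSeries k L V i).toSubmodule, antitone_lowerCentralSeries k L V,
    rfl, congrArg LieSubmodule.toSubmodule lowerCentralSeries_finrank_eq_bot, fun X i v hv => ?_⟩
  change φ X v ∈ lowerCentralSeries k L V (i + 1)
  rw [lowerCentralSeries_succ]
  exact LieSubmodule.lie_mem_lie (LieSubmodule.mem_top X) hv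

end Flag

section EndFiltration

variable {k V : Type*} [Field k] [AddCommGroup V] [Module k V] {F : ℕ → Submodule k V}

/-- The endomorphisms that lower the filtration `F` by `i` steps. -/
def endFiltration (F : ℕ → Submodule k V) (i : ℕ) : Submodule k (End k V) where
  carrier := {T | ∀ j, ∀ v ∈ F j, T v ∈ F (j + i)}
  zero_mem' _ _ _ := zero_mem _
  add_mem' hS hT j v hv := add_mem (hS j v hv) (hT j v hv)
  smul_mem' c _ hT j v hv := Submodule.smul_mem _ c (hT j v hv)

theorem isNilFiltration_endFiltration {d : ℕ} (hF : Antitone F) (htop : F 0 = ⊤)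
    (hbot : F d = ⊥) : IsNilFiltration (endFiltration F) d where
  one_mem _ _ hv := hv
  mul_mem {i j a b} ha hb l v hv := by
    have hab := ha _ _ (hb l v hv)
    rwa [add_assoc, add_comm j i] at hab
  antitone _ _ hij _ hT l v hv := hF (by omega) (hT l v hv)
  eq_bot i hi := by
    refine eq_bot_iff.2 fun T hT => LinearMap.ext fun v => ?_
    have hv : T v ∈ F (0 + i) := hT 0 v (htop ▸ Submodule.mem_top)
    simpa [hbot] using hF hi (zero_add i ▸ hv)

end EndFiltration

section Adapted

variable {k B : Type*} [Field k] [Ring B] [Algebra k B] {n d : ℕ} {E : ℕ → Submodule k B}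
  {φ : strictUpper k n →ₗ⁅k⁆ B}

theorem lie_matrixUnit {i l j : Fin n} (hil : i < l) (hlj : l < j) :
    ⁅matrixUnit k ⟨(i, l), hil⟩, matrixUnit k ⟨(l, j), hlj⟩⁆ =
      matrixUnit k ⟨(i, j), hil.trans hlj⟩ := by
  apply Subtype.ext
  rw [LieSubalgebra.coe_bracket, Ring.lie_def]
  simp [matrixUnit, Matrix.single_mul_single_of_ne, (hil.trans hlj).ne']

theorem isAdapted_of_mem_one (hE : IsNilFiltration E d)
    (hφ : ∀ r, φ (matrixUnit k r) ∈ E 1) : IsAdapted E φ := by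
  have hdist : ∀ m (r : Pos n), (r.1.2 : ℕ) = r.1.1 + (m + 1) →
      φ (matrixUnit k r) ∈ E (m + 1) := by
    intro m
    induction m with
    | zero => exact fun r _ => hφ r
    | succ m ih =>
      rintro ⟨⟨i, j⟩, hij⟩ hr
      simp only at hr
      let l : Fin n := ⟨i + 1, by omega⟩
      have hil : i < l := Fin.lt_def.2 i.1.lt_succ_self
      have hlj : l < j := Fin.lt_def.2 (by simp only [l]; omega)
      have hshort := hφ ⟨(i, l), hil⟩
      have hlong := ih ⟨(l, j), hlj⟩ (by simp only [l]; omega)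
      rw [← lie_matrixUnit hil hlj, LieHom.map_lie, Ring.lie_def]
      exact sub_mem (add_comm 1 (m + 1) ▸ hE.mul_mem hshort hlong) (hE.mul_mem hlong hshort)
  intro r
  have hr := Fin.lt_def.1 r.2
  obtain ⟨m, hm⟩ := Nat.exists_eq_add_of_lt hr
  have hsub : (r.1.2 - r.1.1 : ℕ) = m + 1 := by omega
  exact hsub ▸ hdist m r hm

theorem exists_isNilFiltration_isAdapted {V : Type*} [AddCommGroup V] [Module k V]
    [FiniteDimensional k V] {φ : strictUpper k n →ₗ⁅k⁆ End k V}
    (hφ : ∀ X, _root_.IsNilpotent (φ X)) : ∃ E : ℕ → Submodule k (End k V),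
      IsNilFiltration E (finrank k V) ∧ IsAdapted E φ := by
  obtain ⟨F, hanti, htop, hbot, hF⟩ := exists_flag_of_isNilpotent φ hφ
  have hE := isNilFiltration_endFiltration hanti htop hbot
  exact ⟨endFiltration F, hE, isAdapted_of_mem_one hE fun r => hF (matrixUnit k r)⟩

end Adapted

end Engel

/-! ### Matrix formulas and intertwiners -/

section Coaction

open Module TensorProduct

section Intertwines

variable {k V W R R' : Type*} [CommRing k] [AddCommGroup V] [Module k V] [AddCommGroup W]
  [Module k W] [AddCommGroup R] [Module k R] [AddCommGroup R'] [Module k R']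

/-- The linear map `V → V ⊗ R` with matrix formula in `End V ⊗ R`; unlike `toCoaction`, it allows
an arbitrary module `R` of coefficients and is linear in the formula. -/
noncomputable abbrev coact : End k V ⊗[k] R →ₗ[k] V →ₗ[k] V ⊗[k] R :=
  rTensorHomToHomRTensor (RingHom.id k) V V R

theorem lTensor_comp_coact (h : R →ₗ[k] R') (Θ : End k V ⊗[k] R) :
    h.lTensor V ∘ₗ coact Θ = coact (h.lTensor (End k V) Θ) := by
  induction Θ with
  | zero => simp
  | add x y hx hy => simp only [map_add, LinearMap.comp_add, hx, hy]
  | tmul T a => exact LinearMap.ext fun v => by simp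

theorem coact_bijective [Module.Free k V] [Module.Finite k V] :
    Function.Bijective (coact : End k V ⊗[k] R →ₗ[k] V →ₗ[k] V ⊗[k] R) := by
  have hcoe : ⇑(rTensorHomEquivHomRTensor k V V R) = coact :=
    funext fun Θ => rTensorHomEquivHomRTensor_apply Θ
  exact hcoe ▸ (rTensorHomEquivHomRTensor k V V R).bijective

/-- `f Θ = Ξ f`, for matrix formulas `Θ` and `Ξ` with coefficients in an arbitrary module. -/
def Intertwines (f : V →ₗ[k] W) (Θ : End k V ⊗[k] R) (Ξ : End k W ⊗[k] R) : Prop :=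
  f.rTensor R ∘ₗ coact Θ = coact Ξ ∘ₗ f

variable {f : V →ₗ[k] W} {Θ : End k V ⊗[k] R} {Ξ : End k W ⊗[k] R}

theorem Intertwines.lTensor (hf : Intertwines f Θ Ξ) (h : R →ₗ[k] R') :
    Intertwines f (h.lTensor (End k V) Θ) (h.lTensor (End k W) Ξ) := by
  rw [Intertwines, ← lTensor_comp_coact, ← lTensor_comp_coact, ← LinearMap.comp_assoc,
    LinearMap.rTensor_comp_lTensor, ← LinearMap.lTensor_comp_rTensor, LinearMap.comp_assoc, hf,
    LinearMap.comp_assoc]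

theorem Intertwines.of_lTensor [Module.Flat k W] {h : R →ₗ[k] R'} (hh : Function.Injective h)
    (hf : Intertwines f (h.lTensor (End k V) Θ) (h.lTensor (End k W) Ξ)) :
    Intertwines f Θ Ξ := by
  have hinj := Module.Flat.lTensor_preserves_injective_linearMap (M := W) h hh
  rw [Intertwines, ← lTensor_comp_coact, ← lTensor_comp_coact, ← LinearMap.comp_assoc,
    LinearMap.rTensor_comp_lTensor, ← LinearMap.lTensor_comp_rTensor, LinearMap.comp_assoc,
    LinearMap.comp_assoc] at hf
  exact LinearMap.ext fun v => hinj (LinearMap.congr_fun hf v)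

end Intertwines

section Algebra

variable {k V W R : Type*} [CommRing k] [AddCommGroup V] [Module k V] [AddCommGroup W]
  [Module k W] [CommRing R] [Algebra k R]

/-- The action of `End V ⊗ R` on `V ⊗ R`; products of matrix formulas become compositions. -/
noncomputable def opHom (k V R : Type*) [CommRing k] [AddCommGroup V] [Module k V] [CommRing R]
    [Algebra k R] : End k V ⊗[k] R →ₐ[k] End k (V ⊗[k] R) :=
  (endTensorEndAlgHom (R := k) (S := k) (A := k) (M := V) (N := R)).comp
    (Algebra.TensorProduct.map (AlgHom.id k _) (Algebra.lmul k R))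

@[simp]
theorem opHom_tmul (T : End k V) (a : R) (v : V) (b : R) :
    opHom k V R (T ⊗ₜ[k] a) (v ⊗ₜ[k] b) = T v ⊗ₜ[k] (a * b) := rfl

theorem opHom_apply (Θ : End k V ⊗[k] R) (v : V) (b : R) :
    opHom k V R Θ (v ⊗ₜ[k] b) = (LinearMap.mulRight k b).lTensor V (coact Θ v) := by
  induction Θ with
  | zero => simp
  | add x y hx hy => simp only [map_add, LinearMap.add_apply, hx, hy]
  | tmul T a => simp

variable {f : V →ₗ[k] W} {Θ Θ' : End k V ⊗[k] R} {Ξ Ξ' Ξinv : End k W ⊗[k] R}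

theorem intertwines_iff_opHom :
    Intertwines f Θ Ξ ↔ f.rTensor R ∘ₗ opHom k V R Θ = opHom k W R Ξ ∘ₗ f.rTensor R := by
  constructor
  · intro h
    refine TensorProduct.ext' fun v b => ?_
    rw [LinearMap.comp_apply, LinearMap.comp_apply, LinearMap.rTensor_tmul, opHom_apply,
      opHom_apply, ← LinearMap.comp_apply, LinearMap.rTensor_comp_lTensor,
      ← LinearMap.lTensor_comp_rTensor, LinearMap.comp_apply]
    exact congrArg _ (LinearMap.congr_fun h v)
  · intro h
    ext v
    simpa [opHom_apply] using LinearMap.congr_fun h (v ⊗ₜ 1)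

/-- The pairs `(Θ, Ξ)` with `f Θ = Ξ f`. -/
noncomputable def intertwinedPairs (f : V →ₗ[k] W) (R : Type*) [CommRing R] [Algebra k R] :
    Subalgebra k ((End k V ⊗[k] R) × (End k W ⊗[k] R)) where
  carrier := {x | Intertwines f x.1 x.2}
  mul_mem' {x y} hx hy := by
    rw [Set.mem_ofPred_eq, intertwines_iff_opHom] at *
    rw [Prod.fst_mul, Prod.snd_mul, map_mul, map_mul, End.mul_eq_comp, End.mul_eq_comp,
      ← LinearMap.comp_assoc, hx, LinearMap.comp_assoc, hy, LinearMap.comp_assoc]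
  add_mem' {x y} hx hy := by
    rw [Set.mem_ofPred_eq, Intertwines] at *
    rw [Prod.fst_add, Prod.snd_add, map_add, map_add, LinearMap.comp_add, LinearMap.add_comp, hx,
      hy]
  algebraMap_mem' c := LinearMap.ext fun v => by simp [Algebra.TensorProduct.algebraMap_apply]

theorem Intertwines.mul (h : Intertwines f Θ Ξ) (h' : Intertwines f Θ' Ξ') :
    Intertwines f (Θ * Θ') (Ξ * Ξ') :=
  (intertwinedPairs f R).mul_mem (x := (Θ, Ξ)) (y := (Θ', Ξ')) h h'

theorem intertwines_one (f : V →ₗ[k] W) :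
    Intertwines f (1 : End k V ⊗[k] R) (1 : End k W ⊗[k] R) :=
  (intertwinedPairs f R).one_mem

theorem Intertwines.aeval (h : Intertwines f Θ Ξ) (q : Polynomial k) :
    Intertwines f (Polynomial.aeval Θ q) (Polynomial.aeval Ξ q) := by
  have hmem : Polynomial.aeval (Θ, Ξ) q ∈ intertwinedPairs f R := aeval_mem_subalgebra h q
  rwa [Polynomial.aeval_prod_apply] at hmem

theorem Intertwines.sum {ι : Type*} {s : Finset ι} {Θ : ι → End k V ⊗[k] R}
    {Ξ : ι → End k W ⊗[k] R} (h : ∀ i ∈ s, Intertwines f (Θ i) (Ξ i)) :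
    Intertwines f (∑ i ∈ s, Θ i) (∑ i ∈ s, Ξ i) := by
  have hmem : ∑ i ∈ s, (Θ i, Ξ i) ∈ intertwinedPairs f R := sum_mem h
  rwa [← prod_mk_sum] at hmem

theorem Intertwines.of_mul (hinv : Ξinv * Ξ = 1) (h : Intertwines f Θ Ξ)
    (h' : Intertwines f (Θ * Θ') (Ξ * Ξ')) : Intertwines f Θ' Ξ' := by
  rw [intertwines_iff_opHom] at *
  calc f.rTensor R ∘ₗ opHom k V R Θ'
      = opHom k W R Ξinv ∘ₗ (opHom k W R Ξ ∘ₗ f.rTensor R) ∘ₗ opHom k V R Θ' := by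
        rw [LinearMap.comp_assoc, ← LinearMap.comp_assoc _ _ (opHom k W R Ξinv),
          ← End.mul_eq_comp, ← map_mul, hinv, map_one, End.one_eq_id, LinearMap.id_comp]
    _ = opHom k W R Ξinv ∘ₗ f.rTensor R ∘ₗ opHom k V R (Θ * Θ') := by
        rw [← h, map_mul, End.mul_eq_comp, LinearMap.comp_assoc]
    _ = opHom k W R Ξ' ∘ₗ f.rTensor R := by
        rw [h', ← LinearMap.comp_assoc, ← End.mul_eq_comp, ← map_mul, ← mul_assoc, hinv, one_mul]

theorem intertwines_of_commute {f : End k V} (h : Commute (f ⊗ₜ[k] (1 : R)) Θ) :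
    Intertwines f Θ Θ := by
  have hf : opHom k V R (f ⊗ₜ[k] (1 : R)) = f.rTensor R :=
    TensorProduct.ext' fun v b => by simp
  rw [intertwines_iff_opHom, ← hf, ← End.mul_eq_comp, ← End.mul_eq_comp, ← map_mul, ← map_mul,
    h.eq]

end Algebra

section Representation

variable {k V W : Type*} [Field k] {n : ℕ} [AddCommGroup V] [Module k V] [AddCommGroup W]
  [Module k W] {f : V →ₗ[k] W} {Θ : End k V ⊗[k] CoordRing k n} {Ξ : End k W ⊗[k] CoordRing k n}

theorem isMorphism_toCoaction_iff :
    IsMorphism f (toCoaction Θ) (toCoaction Ξ) ↔ Intertwines f Θ Ξ := Iff.rfl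

theorem intertwines_expRep {R : Type*} [CommRing R] [Algebra k R] {p : ℕ}
    {φ : strictUpper k n →ₗ⁅k⁆ End k V} {ψ : strictUpper k n →ₗ⁅k⁆ End k W}
    (h : ∀ X, f ∘ₗ φ X = ψ X ∘ₗ f) (g : Matrix (Fin n) (Fin n) R) :
    Intertwines f (expRep p φ g) (expRep p ψ g) := by
  refine Intertwines.aeval ?_ _
  rw [extend_apply, extend_apply]
  refine Intertwines.sum fun r _ => LinearMap.ext fun v => ?_
  simpa using congrArg (· ⊗ₜ[k] _) (LinearMap.congr_fun (h (matrixUnit k r)) v)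

theorem rid_counit_coact (Θ : End k V ⊗[k] CoordRing k n) :
    (TensorProduct.rid k V).toLinearMap ∘ₗ (counit k n).toLinearMap.lTensor V ∘ₗ coact Θ =
      evalOne k n (End k V) Θ := by
  induction Θ with
  | zero => simp
  | add x y hx hy => simp only [map_add, LinearMap.comp_add, hx, hy]
  | tmul T a => exact LinearMap.ext fun v => by simp

theorem Intertwines.comp_evalOne (h : Intertwines f Θ Ξ) :
    f ∘ₗ evalOne k n (End k V) Θ = evalOne k n (End k W) Ξ ∘ₗ f := by
  have hrid : f ∘ₗ (TensorProduct.rid k V).toLinearMap =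
      (TensorProduct.rid k W).toLinearMap ∘ₗ f.rTensor k :=
    TensorProduct.ext' fun v c => by simp
  rw [← rid_counit_coact, ← rid_counit_coact, ← LinearMap.comp_assoc, hrid, lTensor_comp_coact,
    lTensor_comp_coact, LinearMap.comp_assoc, h.lTensor, LinearMap.comp_assoc]

theorem Intertwines.comp_differential (h : Intertwines f Θ Ξ) (X : strictUpper k n) :
    f ∘ₗ differential Θ X = differential Ξ X ∘ₗ f :=
  (h.lTensor (invDeriv X.1).toLinearMap).comp_evalOne

theorem assoc_rTensor_coact (Θ Θ' : End k V ⊗[k] CoordRing k n) :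
    (TensorProduct.assoc k V (CoordRing k n) (CoordRing k n)).toLinearMap ∘ₗ
        (coact Θ).rTensor (CoordRing k n) ∘ₗ coact Θ' =
      coact (coeffMap (End k V) (inclLeft k n) Θ * coeffMap (End k V) (inclRight k n) Θ') := by
  induction Θ' with
  | zero => simp
  | add x y hx hy => simp only [map_add, LinearMap.comp_add, mul_add, hx, hy]
  | tmul T' a' =>
    induction Θ with
    | zero => simp
    | add x y hx hy =>
      simp only [map_add, LinearMap.rTensor_add, LinearMap.comp_add, LinearMap.add_comp, add_mul,
        hx, hy]
    | tmul T a => exact LinearMap.ext fun v => by simp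

theorem isRepresentation_toCoaction_iff [FiniteDimensional k V] :
    IsRepresentation (toCoaction Θ) ↔ IsRepElement Θ := by
  have hcoassoc : (TensorProduct.assoc k V (CoordRing k n) (CoordRing k n)).toLinearMap ∘ₗ
        (coact Θ).rTensor (CoordRing k n) ∘ₗ coact Θ =
          (comul k n).toLinearMap.lTensor V ∘ₗ coact Θ ↔
      coeffMap (End k V) (comul k n) Θ =
        coeffMap (End k V) (inclLeft k n) Θ * coeffMap (End k V) (inclRight k n) Θ := by
    rw [assoc_rTensor_coact, lTensor_comp_coact, coact_bijective.injective.eq_iff, eq_comm]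
    rfl
  exact ⟨fun h => ⟨hcoassoc.1 h.1, (rid_counit_coact Θ).symm.trans h.2⟩,
    fun h => ⟨hcoassoc.2 h.1, (rid_counit_coact Θ).trans h.2⟩⟩

end Representation

end Coaction

/-! ### Frobenius descent -/

section Frobenius

open MvPolynomial

theorem derivation_sum_apply {ι k A M : Type*} [CommRing k] [CommRing A] [Algebra k A]
    [AddCommGroup M] [Module k M] [Module A M] (s : Finset ι) (D : ι → Derivation k A M) (a : A) :
    (∑ i ∈ s, D i) a = ∑ i ∈ s, D i a := by
  rw [← Derivation.coeFnAddMonoidHom_apply, map_sum, Finset.sum_apply]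
  rfl

section Expand

variable {k σ M : Type*} [CommRing k] {p : ℕ} [CharP k p]

theorem derivation_expand [AddCommGroup M] [Module k M] [Module (MvPolynomial σ k) M]
    (D : Derivation k (MvPolynomial σ k) M) (f : MvPolynomial σ k) : D (expand p f) = 0 := by
  have hchar : (p : k) = 0 := CharP.cast_eq_zero k p
  induction f using MvPolynomial.induction_on with
  | C c => simp
  | add f g hf hg => rw [map_add, map_add, hf, hg, add_zero]
  | mul_X f r hf =>
    rw [map_mul, expand_X, Derivation.leibniz, hf, Derivation.leibniz_pow,
      ← Nat.cast_smul_eq_nsmul k, hchar, zero_smul, smul_zero, smul_zero, add_zero]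

theorem lTensor_derivation_coeffMap_expand {B : Type*} [Ring B] [Algebra k B]
    (D : Derivation k (MvPolynomial σ k) (MvPolynomial σ k)) (x : B ⊗[k] MvPolynomial σ k) :
    D.toLinearMap.lTensor B (coeffMap B (expand p) x) = 0 := by
  have hzero : D.toLinearMap ∘ₗ (expand p : MvPolynomial σ k →ₐ[k] _).toLinearMap = 0 :=
    LinearMap.ext (derivation_expand D)
  rw [coeffMap_apply, ← LinearMap.lTensor_comp_apply, hzero, LinearMap.lTensor_zero,
    LinearMap.zero_apply]

end Expand

section Contract

variable {k σ : Type*} [CommRing k] {B : Type*} [Ring B] [Algebra k B] {p : ℕ} [NeZero p]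

theorem lTensor_contract_mem_degLE {D : ℕ} {x : B ⊗[k] MvPolynomial σ k}
    (hx : x ∈ degLE k B σ k D) : (contract p).lTensor B x ∈ degLE k B σ k (D / p) := by
  have hle : degLE k B σ k D ≤ (degLE k B σ k (D / p)).comap ((contract p).lTensor B) := by
    rw [degLE, Submodule.span_le]
    rintro _ ⟨b, f, hf, rfl⟩
    exact tmul_mem_degLE b ((totalDegree_contract_le f).trans (Nat.div_le_div_right hf))
  exact hle hx

theorem lTensor_contract_coeffMap_expand_mul (x y : B ⊗[k] MvPolynomial σ k) :
    (contract p).lTensor B (coeffMap B (expand p) x * y) = x * (contract p).lTensor B y := by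
  induction x with
  | zero => simp
  | add x x' hx hx' => rw [map_add, add_mul, map_add, hx, hx', add_mul]
  | tmul b f =>
    induction y with
    | zero => simp
    | add y y' hy hy' => rw [mul_add, map_add, hy, hy', map_add, mul_add]
    | tmul c g => simp [contract_expand_mul]

end Contract

section InvDeriv

variable {k : Type*} [Field k] {n : ℕ} {B : Type*} [Ring B] [Algebra k B]

theorem map_derivation_generic_mem_band (D : Derivation k (CoordRing k n) (CoordRing k n)) :
    (generic k n).map D ∈ band n (CoordRing k n) 1 := by
  have hmap : (generic k n - 1).map D = (generic k n).map D := by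
    ext1 i j
    rcases eq_or_ne i j with rfl | hij <;> simp [*]
  exact hmap ▸ map_mem_band generic_sub_one_mem (map_zero D)

theorem exists_derivation_eq_sum_smul_invDeriv
    (D : Derivation k (CoordRing k n) (CoordRing k n)) :
    ∃ c : Pos n → CoordRing k n, D = ∑ s, c s • invDeriv (matrixUnit k s).1 := by
  obtain ⟨g', hg'_mem, hg', -⟩ := exists_inverse (generic_sub_one_mem (k := k) (n := n))
  set M := g' * (generic k n).map D
  have hM : M ∈ band n _ 1 := by
    simpa only [zero_add] using mul_mem_band hg'_mem (map_derivation_generic_mem_band D)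
  have hgM : generic k n * M = (generic k n).map D := by rw [← mul_assoc, hg', one_mul]
  refine ⟨fun s => M s.1.1 s.1.2, derivation_ext fun r => ?_⟩
  have hsum : generic k n * M = ∑ s : Pos n, M s.1.1 s.1.2 •
      (generic k n * (matrixUnit k s).1.map (algebraMap k (CoordRing k n))) := by
    conv_lhs => rw [eq_sum_single hM, Finset.mul_sum]
    refine Finset.sum_congr rfl fun s _ => ?_
    rw [← mul_smul_comm]
    congr 1
    ext1 i j
    simp only [matrixUnit, Matrix.smul_apply, Matrix.map_apply, Matrix.single_apply]
    split_ifs <;> simp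
  have hentry := congrFun (congrFun (hgM.symm.trans hsum) r.1.1) r.1.2
  rw [Matrix.map_apply, generic_apply, Matrix.sum_apply] at hentry
  rw [hentry, derivation_sum_apply]
  simp only [Derivation.smul_apply, invDeriv_X, Matrix.smul_apply]

theorem derivation_eq_zero_of_invDeriv_eq_zero {f : CoordRing k n}
    (hf : ∀ X : strictUpper k n, invDeriv X.1 f = 0)
    (D : Derivation k (CoordRing k n) (CoordRing k n)) : D f = 0 := by
  obtain ⟨c, rfl⟩ := exists_derivation_eq_sum_smul_invDeriv D
  rw [derivation_sum_apply]
  exact Finset.sum_eq_zero fun s _ => by rw [Derivation.smul_apply, hf, smul_zero]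

theorem eq_tmul_one_of_mem_degLE_zero {x : B ⊗[k] CoordRing k n}
    (hx : x ∈ degLE k B (Pos n) k 0) : x = evalOne k n B x ⊗ₜ[k] 1 := by
  induction hx using Submodule.span_induction with
  | mem x hx =>
    obtain ⟨b, f, hf, rfl⟩ := hx
    obtain ⟨c, rfl⟩ : ∃ c, f = C c := ⟨_, totalDegree_eq_zero_iff_eq_C.1 (Nat.le_zero.1 hf)⟩
    rw [evalOne_tmul, TensorProduct.smul_tmul, ← algebraMap_eq, AlgHom.commutes,
      Algebra.algebraMap_eq_smul_one]
    rfl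
  | zero => simp
  | add x y _ _ hx hy =>
    rw [map_add, TensorProduct.add_tmul, ← hx, ← hy]
  | smul c x _ hx =>
    rw [map_smul, ← TensorProduct.smul_tmul', ← hx]

variable {p : ℕ} [NeZero p]

theorem evalOne_lTensor_contract (x : B ⊗[k] CoordRing k n) :
    evalOne k n B ((contract p).lTensor B x) = evalOne k n B x := by
  induction x with
  | zero => simp
  | add x y hx hy => rw [map_add, map_add, map_add, hx, hy]
  | tmul b f => simp [counit, constantCoeff_contract]

theorem lTensor_contract_eq_tmul_one {D : ℕ} (hD : D < p) {x : B ⊗[k] CoordRing k n}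
    (hx : x ∈ degLE k B (Pos n) k D) :
    (contract p).lTensor B x = evalOne k n B x ⊗ₜ[k] 1 := by
  have hdeg := lTensor_contract_mem_degLE (p := p) hx
  rw [Nat.div_eq_of_lt hD] at hdeg
  rw [eq_tmul_one_of_mem_degLE_zero hdeg, evalOne_lTensor_contract]

variable [CharP k p]

theorem coeffMap_expand_lTensor_contract {x : B ⊗[k] CoordRing k n}
    (hx : ∀ X : strictUpper k n, (invDeriv X.1).toLinearMap.lTensor B x = 0) :
    coeffMap B (expand p) ((contract p).lTensor B x) = x := by
  refine eq_of_slice_eq fun l => ?_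
  have hslice : ∀ X : strictUpper k n, invDeriv X.1 (slice l x) = 0 := fun X => by
    simpa [slice_lTensor] using congrArg (slice l) (hx X)
  rw [coeffMap_apply, slice_lTensor, slice_lTensor]
  exact expand_contract fun m hm => dvd_of_pderiv_eq_zero k
    (fun r => derivation_eq_zero_of_invDeriv_eq_zero hslice (pderiv r)) hm

end InvDeriv

section Commute

theorem commute_one_tmul {k B R : Type*} [CommRing k] [Ring B] [Algebra k B] [CommRing R]
    [Algebra k R] (a : R) (x : B ⊗[k] R) : Commute ((1 : B) ⊗ₜ[k] a) x := by
  induction x with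
  | zero => exact Commute.zero_right _
  | tmul b c => simp [Commute, SemiconjBy, mul_comm a c]
  | add y z hy hz => exact hy.add_right hz

theorem commute_tmul {k B R : Type*} [CommRing k] [Ring B] [Algebra k B] [CommRing R] [Algebra k R]
    {b : B} {x : B ⊗[k] R} (h : Commute (b ⊗ₜ[k] 1) x) (a : R) : Commute (b ⊗ₜ[k] a) x := by
  simpa using h.mul_left (commute_one_tmul a x)

variable {k : Type*} [Field k] {n : ℕ} {B : Type*} [Ring B] [Algebra k B] {R : Type*} [CommRing R]
  [Algebra k R]

theorem commute_expRep {p : ℕ} {φ : strictUpper k n →ₗ⁅k⁆ B} {x : B ⊗[k] R}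
    (hx : ∀ X, Commute (φ X ⊗ₜ[k] (1 : R)) x) (g : Matrix (Fin n) (Fin n) R) :
    Commute (expRep p φ g) x := by
  have hcentral : extend φ R (logMatrix k p g) ∈ Subalgebra.centralizer k {x} := by
    rw [extend_apply]
    refine sum_mem fun r _ => Subalgebra.mem_centralizer_iff k |>.2 ?_
    rintro _ rfl
    exact (commute_tmul (hx _) _).symm
  exact ((Subalgebra.mem_centralizer_iff k).1 (aeval_mem_subalgebra hcentral (expPoly k p)) x
    rfl).symm

end Commute

end Frobenius

section FrobeniusQuotient

open MvPolynomial

variable {k : Type*} [Field k] {n : ℕ} {B : Type*} [Ring B] [Algebra k B]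
  {Φ Θ Θ' P Ψ : B ⊗[k] CoordRing k n}

theorem comul_mul_inclLeft_of_mul_eq (hΦ : IsRepElement Φ) (hΘ : IsRepElement Θ)
    (hΘΘ' : Θ * Θ' = 1) (hP : P * Θ = Φ) :
    coeffMap B (comul k n) P * coeffMap B (inclLeft k n) Θ =
      coeffMap B (inclLeft k n) Φ * coeffMap B (inclRight k n) P := by
  have hcancel : coeffMap B (inclRight k n) Θ * coeffMap B (inclRight k n) Θ' = 1 := by
    rw [← map_mul, hΘΘ', map_one]
  calc coeffMap B (comul k n) P * coeffMap B (inclLeft k n) Θ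
      = coeffMap B (comul k n) P * coeffMap B (comul k n) Θ * coeffMap B (inclRight k n) Θ' := by
        rw [hΘ.comul_eq, mul_assoc, mul_assoc, hcancel, mul_one]
    _ = coeffMap B (inclLeft k n) Φ * coeffMap B (inclRight k n) Φ *
          coeffMap B (inclRight k n) Θ' := by
        rw [← map_mul, hP, hΦ.comul_eq]
    _ = coeffMap B (inclLeft k n) Φ * coeffMap B (inclRight k n) P := by
        rw [← hP, map_mul (coeffMap B (inclRight k n)), mul_assoc, mul_assoc, hcancel, mul_one]

theorem isRepElement_of_mul_eq (hΦ : IsRepElement Φ) (hΘ : IsRepElement Θ) (hΘΘ' : Θ * Θ' = 1)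
    (hP : P * Θ = Φ)
    (hcomm : Commute (coeffMap B (inclLeft k n) Θ) (coeffMap B (inclRight k n) P)) :
    IsRepElement P where
  comul_eq := by
    have hcancel : coeffMap B (inclLeft k n) Θ * coeffMap B (inclLeft k n) Θ' = 1 := by
      rw [← map_mul, hΘΘ', map_one]
    have hmul := comul_mul_inclLeft_of_mul_eq hΦ hΘ hΘΘ' hP
    rw [← hP, map_mul, mul_assoc, hcomm.eq, ← mul_assoc] at hmul
    simpa only [mul_assoc, hcancel, mul_one] using congrArg (· * coeffMap B (inclLeft k n) Θ') hmul
  evalOne_eq := by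
    simpa only [map_mul, hΘ.evalOne_eq, mul_one, hΦ.evalOne_eq] using congrArg (evalOne k n B) hP

theorem coeffMap_projRight_comul (x : B ⊗[k] CoordRing k n) :
    coeffMap B (projRight k n) (coeffMap B (comul k n) x) = x := by
  have hid : (projRight k n).comp (comul k n) = AlgHom.id k _ := AlgHom.ext projRight_comul
  rw [coeffMap_coeffMap, hid, coeffMap_id]

theorem commute_tmul_one_of_coeffMap {R S : Type*} [CommRing R] [Algebra k R] [CommRing S]
    [Algebra k S] {u : R →ₐ[k] S} (hu : Function.Injective u) {b : B} {x : B ⊗[k] R}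
    (h : Commute (b ⊗ₜ[k] 1) (coeffMap B u x)) : Commute (b ⊗ₜ[k] 1) x :=
  coeffMap_injective hu (by simpa using h.eq)

theorem commute_coeffMap_expRep {R S : Type*} [CommRing R] [Algebra k R] [CommRing S]
    [Algebra k S] {p : ℕ} {φ : strictUpper k n →ₗ⁅k⁆ B} {x : B ⊗[k] R}
    (hx : ∀ X, Commute (φ X ⊗ₜ[k] 1) x) (u v : R →ₐ[k] S) (g : Matrix (Fin n) (Fin n) R) :
    Commute (coeffMap B u (expRep p φ g)) (coeffMap B v x) := by
  rw [coeffMap_expRep]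
  exact commute_expRep (fun X => by simpa using (hx X).map (coeffMap B v)) _

variable {p : ℕ} [hp : Fact p.Prime] [CharP k p]

theorem derivLeft_comul_expand (D : Derivation k (CoordRing k n) (CoordRing k n))
    (f : CoordRing k n) : derivLeft (CoordRing k n) D (comul k n (expand p f)) = 0 := by
  rw [comul_expand]
  induction comul k n f with
  | zero => simp
  | add x y hx hy => rw [map_add, map_add, hx, hy, add_zero]
  | tmul b c => simp [derivation_expand]

theorem lTensor_derivLeft_comul_expand (D : Derivation k (CoordRing k n) (CoordRing k n))
    (Ψ : B ⊗[k] CoordRing k n) :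
    (derivLeft (CoordRing k n) D).toLinearMap.lTensor B
      (coeffMap B (comul k n) (coeffMap B (expand p) Ψ)) = 0 := by
  have hzero : (derivLeft (CoordRing k n) D).toLinearMap ∘ₗ
      ((comul k n).comp (expand p)).toLinearMap = 0 := LinearMap.ext (derivLeft_comul_expand D)
  rw [coeffMap_coeffMap, coeffMap_apply, ← LinearMap.lTensor_comp_apply, hzero,
    LinearMap.lTensor_zero, LinearMap.zero_apply]

theorem mul_differential_eq_differential_mul (hP : coeffMap B (expand p) Ψ = P)
    (h : coeffMap B (comul k n) P * coeffMap B (inclLeft k n) Θ =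
      coeffMap B (inclLeft k n) Φ * coeffMap B (inclRight k n) P) (X : strictUpper k n) :
    P * differential Θ X ⊗ₜ[k] 1 = differential Φ X ⊗ₜ[k] 1 * P := by
  have hderiv := congrArg ((derivLeft _ (invDeriv X.1)).toLinearMap.lTensor B) h
  rw [lTensor_derivation_mul, lTensor_derivation_mul, lTensor_derivLeft_includeLeft,
    lTensor_derivLeft_includeLeft, lTensor_derivLeft_includeRight, mul_zero, add_zero, ← hP,
    lTensor_derivLeft_comul_expand, zero_mul, zero_add, hP] at hderiv
  have hrestrict := congrArg (coeffMap B (projRight k n)) hderiv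
  rwa [map_mul, map_mul, coeffMap_projRight_comul, projRight_inclLeft, projRight_inclLeft,
    projRight_inclRight] at hrestrict

theorem exists_eq_expRep_mul_coeffMap_expand {E : ℕ → Submodule k B} {d D : ℕ} (hn : n ≤ p)
    (hd : d ≤ p) (hΦ : IsRepElement Φ) (hE : IsNilFiltration E d)
    (hφ : IsAdapted E (differentialHom hΦ)) (hD : Φ ∈ degLE k B (Pos n) k (D + 1)) :
    ∃ Ψ ∈ degLE k B (Pos n) k D, IsRepElement Ψ ∧
      (∀ X, Commute (differentialHom hΦ X ⊗ₜ[k] 1) Ψ) ∧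
      Φ = expRep p (differentialHom hΦ) (generic k n) * coeffMap B (expand p) Ψ := by
  set φ := differentialHom hΦ
  set Θ := expRep p φ (generic k n)
  set Θ' := expRepInv p φ (generic k n)
  have hΘ : IsRepElement Θ := isRepElement_expRep hE hφ hd hn
  have hΘΘ' : Θ * Θ' = 1 := expRep_mul_expRepInv hE hφ hd _
  have hΘ'Θ : Θ' * Θ = 1 := expRepInv_mul_expRep hE hφ hd _
  set Ψ := (contract p).lTensor B (Φ * Θ')
  have hΨ : coeffMap B (expand p) Ψ = Φ * Θ' := coeffMap_expand_lTensor_contract fun X =>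
    derivation_mul_inverse_eq_zero (lTensor_derivation_mul _) hΘΘ' hΘ'Θ (lTensor_invDeriv hΦ X)
      (lTensor_invDeriv_expRep hE hφ hd hn X)
  have hquot : Φ * Θ' * Θ = Φ := by rw [mul_assoc, hΘ'Θ, mul_one]
  have hcomm : ∀ X, Commute (φ X ⊗ₜ[k] 1) (Φ * Θ') := fun X => by
    have hX := mul_differential_eq_differential_mul hΨ
      (comul_mul_inclLeft_of_mul_eq hΦ hΘ hΘΘ' hquot) X
    rw [differential_expRep hE hφ hd hn] at hX
    exact hX.symm
  -- `Θ` has degree less than `p` and value `1` at the identity, so it contracts to `1`.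
  have hcontract : (contract p).lTensor B Φ = Ψ := by
    have hΘdeg : Θ ∈ degLE k B (Pos n) k (d - 1) :=
      degFil_le_degLE hE (expRep_mem_degFil hE hφ genericMatrix_mem_degBand)
    have hlt : d - 1 < p := by have := hp.out.pos; omega
    rw [← hquot, ← hΨ, lTensor_contract_coeffMap_expand_mul, lTensor_contract_eq_tmul_one hlt hΘdeg,
      hΘ.evalOne_eq, ← Algebra.TensorProduct.one_def, mul_one]
  have hdeg : Ψ ∈ degLE k B (Pos n) k D := by
    have hlt : (D + 1) / p < D + 1 := Nat.div_lt_self D.succ_pos hp.out.one_lt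
    exact hcontract ▸ degLE_mono (Nat.lt_succ_iff.1 hlt) (lTensor_contract_mem_degLE hD)
  refine ⟨Ψ, hdeg, (isRepElement_coeffMap_expand (p := p)).1 ?_, fun X => ?_, ?_⟩
  · rw [hΨ]
    exact isRepElement_of_mul_eq hΦ hΘ hΘΘ' hquot (commute_coeffMap_expRep hcomm _ _ _)
  · exact commute_tmul_one_of_coeffMap (u := expand p) (expand_injective hp.out.pos)
      (hΨ.symm ▸ hcomm X)
  · rw [hΨ, (commute_expRep hcomm (generic k n)).eq, hquot]

end FrobeniusQuotient

/-! ### Decompositions -/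

section Decomposition

open MvPolynomial

section ExpProd

variable {k : Type*} [Field k] {n p : ℕ} {B : Type*} [Ring B] [Algebra k B]

/-- The product of the `(e^{φ_i(log g)})^{[p^i]}`, with the exponential and the logarithm truncated
below degree `p` instead of at the nilpotency class. -/
noncomputable def expProd (p : ℕ) {l : ℕ} (φ : Fin l → (strictUpper k n →ₗ⁅k⁆ B)) :
    B ⊗[k] CoordRing k n :=
  (List.ofFn fun i : Fin l => coeffMap B (expand (p ^ (i : ℕ)))
    (expRep p (φ i) (generic k n))).prod

theorem expProd_zero (φ : Fin 0 → (strictUpper k n →ₗ⁅k⁆ B)) : expProd p φ = 1 := by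
  rw [expProd, List.ofFn_zero, List.prod_nil]

theorem expProd_succ {l : ℕ} (φ : Fin (l + 1) → (strictUpper k n →ₗ⁅k⁆ B)) :
    expProd p φ = expRep p (φ 0) (generic k n) *
      coeffMap B (expand p) (expProd p fun i => φ i.succ) := by
  rw [expProd, expProd, List.ofFn_succ, List.prod_cons, map_list_prod, List.map_ofFn, Fin.val_zero,
    pow_zero, expand_one, coeffMap_id]
  congr 3
  funext i
  rw [Function.comp_apply, coeffMap_coeffMap, Fin.val_succ, pow_succ', ← expand_mul_eq_comp]

theorem commute_cons {l : ℕ} {φ₀ : strictUpper k n →ₗ⁅k⁆ B}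
    {φ : Fin l → (strictUpper k n →ₗ⁅k⁆ B)} (h₀ : ∀ X j Y, Commute (φ₀ X) (φ j Y))
    (h : ∀ i j, i ≠ j → ∀ X Y, Commute (φ i X) (φ j Y)) (i j : Fin (l + 1)) (hij : i ≠ j)
    (X Y : strictUpper k n) :
    Commute ((Fin.cons φ₀ φ : Fin (l + 1) → (strictUpper k n →ₗ⁅k⁆ B)) i X)
      ((Fin.cons φ₀ φ : Fin (l + 1) → (strictUpper k n →ₗ⁅k⁆ B)) j Y) := by
  cases i using Fin.cases with
  | zero =>
    cases j using Fin.cases with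
    | zero => exact absurd rfl hij
    | succ j => exact h₀ X j Y
  | succ i =>
    cases j using Fin.cases with
    | zero => exact (h₀ Y i X).symm
    | succ j => exact h i j (fun h => hij (congrArg Fin.succ h)) X Y

theorem evalOne_expProd [Fact p.Prime] {l : ℕ} (φ : Fin l → (strictUpper k n →ₗ⁅k⁆ B)) :
    evalOne k n B (expProd p φ) = 1 := by
  induction l with
  | zero => rw [expProd_zero, map_one]
  | succ l ih =>
    have hexp : evalOne k n B (expRep p (φ 0) (generic k n)) = 1 := by
      rw [evalOne, AlgHom.comp_apply, coeffMap_expRep, generic_map_counit, expRep_one, map_one]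
    rw [expProd_succ, map_mul, evalOne_coeffMap_expand, ih, hexp, one_mul]

theorem logGeneric_eq_logMatrix (hn : n ≤ p) :
    logGeneric k n = logMatrix k p (generic k n) := by
  rw [logMatrix, aeval_logPoly, logGeneric]
  refine Finset.sum_subset (Finset.Icc_subset_Icc_right (by omega)) fun j hj hj' => ?_
  rw [Finset.mem_Icc] at hj hj'
  rw [eq_zero_of_mem_band (by omega) (pow_mem_band generic_sub_one_mem j), smul_zero]

variable {V W : Type*} [AddCommGroup V] [Module k V] [FiniteDimensional k V]
  [AddCommGroup W] [Module k W] [FiniteDimensional k W]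

theorem factor_eq_coeffMap_expRep (hn : n ≤ p) (hV : Module.finrank k V ≤ p) {m : ℕ}
    {φ : Fin (m + 1) → (strictUpper k n →ₗ⁅k⁆ Module.End k V)} (i : Fin (m + 1))
    (hφ : ∀ X, IsNilpotent (φ i X)) : factor p φ i =
      coeffMap (Module.End k V) (expand (p ^ (i : ℕ))) (expRep p (φ i) (generic k n)) := by
  obtain ⟨E, hE, hEφ⟩ := exists_isNilFiltration_isAdapted hφ
  have hlog : atLog (φ i) = extend (φ i) _ (logMatrix k p (generic k n)) := by
    rw [atLog, logGeneric_eq_logMatrix hn, extend_apply]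
  rw [factor, hlog, nilExp_eq_aeval_expPoly (extend_pow_eq_zero hE hEφ hV _)]
  rfl

theorem prod_factor_eq_expProd (hn : n ≤ p) (hV : Module.finrank k V ≤ p) {m : ℕ}
    {φ : Fin (m + 1) → (strictUpper k n →ₗ⁅k⁆ Module.End k V)}
    (hφ : ∀ i X, IsNilpotent (φ i X)) :
    (List.ofFn fun i => factor p φ i).prod = expProd p φ := by
  rw [expProd, funext fun i => factor_eq_coeffMap_expRep hn hV i (hφ i)]

theorem intertwines_factor (hn : n ≤ p) (hV : Module.finrank k V ≤ p)
    (hW : Module.finrank k W ≤ p) {f : V →ₗ[k] W} {m : ℕ}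
    {φ : Fin (m + 1) → (strictUpper k n →ₗ⁅k⁆ Module.End k V)}
    {ψ : Fin (m + 1) → (strictUpper k n →ₗ⁅k⁆ Module.End k W)} (i : Fin (m + 1))
    (hφ : ∀ X, IsNilpotent (φ i X)) (hψ : ∀ X, IsNilpotent (ψ i X))
    (h : ∀ X, f ∘ₗ φ i X = ψ i X ∘ₗ f) : Intertwines f (factor p φ i) (factor p ψ i) := by
  rw [factor_eq_coeffMap_expRep hn hV i hφ, factor_eq_coeffMap_expRep hn hW i hψ]
  exact (intertwines_expRep h _).lTensor _

end ExpProd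

variable {k : Type*} [Field k] {n : ℕ} {p : ℕ} [hp : Fact p.Prime] [CharP k p]

theorem isRepElement_coeffMap_expand_pow {B : Type*} [Ring B] [Algebra k B]
    {Θ : B ⊗[k] CoordRing k n} (hΘ : IsRepElement Θ) (i : ℕ) :
    IsRepElement (coeffMap B (expand (p ^ i)) Θ) := by
  induction i with
  | zero => rwa [pow_zero, expand_one, coeffMap_id]
  | succ i ih =>
    rw [pow_succ', expand_mul_eq_comp, ← coeffMap_coeffMap]
    exact isRepElement_coeffMap_expand.2 ih

variable {V W : Type*} [AddCommGroup V] [Module k V] [FiniteDimensional k V]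
  [AddCommGroup W] [Module k W] [FiniteDimensional k W]

theorem isRepElement_factor (hn : n ≤ p) (hV : Module.finrank k V ≤ p) {m : ℕ}
    {φ : Fin (m + 1) → (strictUpper k n →ₗ⁅k⁆ Module.End k V)} (i : Fin (m + 1))
    (hφ : ∀ X, IsNilpotent (φ i X)) : IsRepElement (factor p φ i) := by
  obtain ⟨E, hE, hEφ⟩ := exists_isNilFiltration_isAdapted hφ
  rw [factor_eq_coeffMap_expRep hn hV i hφ]
  exact isRepElement_coeffMap_expand_pow (isRepElement_expRep hE hEφ hV hn) i

theorem differential_expProd (hn : n ≤ p) (hV : Module.finrank k V ≤ p) {l : ℕ}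
    {φ : Fin (l + 1) → (strictUpper k n →ₗ⁅k⁆ Module.End k V)}
    (hφ : ∀ X, IsNilpotent (φ 0 X)) (X : strictUpper k n) :
    differential (expProd p φ) X = φ 0 X := by
  obtain ⟨E, hE, hEφ⟩ := exists_isNilFiltration_isAdapted hφ
  rw [differential, expProd_succ, lTensor_derivation_mul, lTensor_derivation_coeffMap_expand,
    mul_zero, add_zero, map_mul, evalOne_coeffMap_expand, evalOne_expProd, mul_one]
  exact differential_expRep hE hEφ hV hn X

theorem comp_eq_of_intertwines_expProd (hn : n ≤ p) (hV : Module.finrank k V ≤ p)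
    (hW : Module.finrank k W ≤ p) {f : V →ₗ[k] W} {l : ℕ}
    {φ : Fin l → (strictUpper k n →ₗ⁅k⁆ Module.End k V)}
    {ψ : Fin l → (strictUpper k n →ₗ⁅k⁆ Module.End k W)}
    (hφ : ∀ i X, IsNilpotent (φ i X)) (hψ : ∀ i X, IsNilpotent (ψ i X))
    (h : Intertwines f (expProd p φ) (expProd p ψ)) (i : Fin l) (X : strictUpper k n) :
    f ∘ₗ φ i X = ψ i X ∘ₗ f := by
  induction l with
  | zero => exact i.elim0
  | succ l ih =>
    have hzero : ∀ X, f ∘ₗ φ 0 X = ψ 0 X ∘ₗ f := fun X => by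
      simpa only [differential_expProd hn hV (hφ 0), differential_expProd hn hW (hψ 0)] using
        h.comp_differential X
    obtain ⟨E, hE, hEψ⟩ := exists_isNilFiltration_isAdapted (hψ 0)
    rw [expProd_succ, expProd_succ] at h
    have htwist := Intertwines.of_mul (expRepInv_mul_expRep hE hEψ hW (generic k n))
      (intertwines_expRep hzero (generic k n)) h
    have htail : Intertwines f (expProd p fun i => φ i.succ) (expProd p fun i => ψ i.succ) :=
      Intertwines.of_lTensor (h := (expand p : CoordRing k n →ₐ[k] _).toLinearMap)
        (expand_injective hp.out.pos) htwist
    cases i using Fin.cases with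
    | zero => exact hzero X
    | succ j => exact ih (fun i => hφ i.succ) (fun i => hψ i.succ) htail j

theorem exists_eq_expProd (hn : n ≤ p) (hV : Module.finrank k V ≤ p) (l : ℕ)
    {Φ : Module.End k V ⊗[k] CoordRing k n} (hΦ : IsRepElement Φ)
    (hl : Φ ∈ degLE k (Module.End k V) (Pos n) k l) :
    ∃ φ : Fin l → (strictUpper k n →ₗ⁅k⁆ Module.End k V), (∀ i X, IsNilpotent (φ i X)) ∧
      (∀ i j, i ≠ j → ∀ X Y, Commute (φ i X) (φ j Y)) ∧ Φ = expProd p φ := by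
  induction l generalizing Φ with
  | zero =>
    refine ⟨fun i => i.elim0, fun i => i.elim0, fun i => i.elim0, ?_⟩
    rw [eq_tmul_one_of_mem_degLE_zero hl, hΦ.evalOne_eq, expProd_zero,
      Algebra.TensorProduct.one_def]
  | succ l ih =>
    have hnil : ∀ X, IsNilpotent (differentialHom hΦ X) :=
      fun X => ⟨p, differential_pow_char hn hΦ X⟩
    obtain ⟨E, hE, hEφ⟩ := exists_isNilFiltration_isAdapted hnil
    obtain ⟨Ψ, hΨdeg, hΨ, hcomm, hprod⟩ :=
      exists_eq_expRep_mul_coeffMap_expand hn hV hΦ hE hEφ hl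
    obtain ⟨φ, hφ, hφcomm, rfl⟩ := ih hΨ hΨdeg
    have hcomm₀ : ∀ X j Y, Commute (differentialHom hΦ X) (φ j Y) := fun X j Y =>
      comp_eq_of_intertwines_expProd hn hV hV hφ hφ (intertwines_of_commute (hcomm X)) j Y
    refine ⟨Fin.cons (differentialHom hΦ) φ, Fin.cases hnil hφ, commute_cons hcomm₀ hφcomm, ?_⟩
    rw [expProd_succ]
    exact hprod

end Decomposition

section MainResults

theorem intertwines_list_prod {k V W R : Type*} [CommRing k] [AddCommGroup V] [Module k V]
    [AddCommGroup W] [Module k W] [CommRing R] [Algebra k R] {f : V →ₗ[k] W} {l : ℕ}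
    {Θ : Fin l → Module.End k V ⊗[k] R} {Ξ : Fin l → Module.End k W ⊗[k] R}
    (h : ∀ i, Intertwines f (Θ i) (Ξ i)) :
    Intertwines f (List.ofFn Θ).prod (List.ofFn Ξ).prod := by
  induction l with
  | zero => simpa using intertwines_one f
  | succ l ih =>
    rw [List.ofFn_succ, List.ofFn_succ, List.prod_cons, List.prod_cons]
    exact (h 0).mul (ih fun i => h i.succ)

variable {k V W : Type*} [Field k] [AddCommGroup V] [Module k V] [FiniteDimensional k V]
  [AddCommGroup W] [Module k W] [FiniteDimensional k W] {n p : ℕ} [Fact p.Prime] [CharP k p]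
  {Φ : V →ₗ[k] V ⊗[k] CoordRing k n} {Ψ : W →ₗ[k] W ⊗[k] CoordRing k n}

theorem exists_forall_ge_exists_isDecomposition (hn : n ≤ p) (hV : Module.finrank k V ≤ p)
    (hΦ : IsRepresentation Φ) : ∃ D, ∀ m ≥ D,
      ∃ φ : Fin (m + 1) → (strictUpper k n →ₗ⁅k⁆ Module.End k V), IsDecomposition p φ Φ := by
  obtain ⟨Θ, rfl⟩ := coact_bijective.surjective Φ
  obtain ⟨D, hD⟩ := exists_mem_degLE Θ
  refine ⟨D, fun m hm => ?_⟩
  obtain ⟨φ, hnil, hcomm, rfl⟩ := exists_eq_expProd hn hV (m + 1)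
    (isRepresentation_toCoaction_iff.1 hΦ) (degLE_mono (by omega) hD)
  exact ⟨φ, hnil, hcomm, congrArg toCoaction (prod_factor_eq_expProd hn hV hnil).symm⟩

variable {m : ℕ} {φ : Fin (m + 1) → (strictUpper k n →ₗ⁅k⁆ Module.End k V)}
  {ψ : Fin (m + 1) → (strictUpper k n →ₗ⁅k⁆ Module.End k W)}

theorem IsDecomposition.isRepresentation_factor (hφ : IsDecomposition p φ Φ) (hn : n ≤ p)
    (hV : Module.finrank k V ≤ p) (i : Fin (m + 1)) :
    IsRepresentation (toCoaction (factor p φ i)) :=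
  isRepresentation_toCoaction_iff.2 (isRepElement_factor hn hV i (hφ.nilpotent i))

theorem IsDecomposition.isMorphism_iff (hφ : IsDecomposition p φ Φ) (hψ : IsDecomposition p ψ Ψ)
    (hn : n ≤ p) (hV : Module.finrank k V ≤ p) (hW : Module.finrank k W ≤ p) (f : V →ₗ[k] W) :
    IsMorphism f Φ Ψ ↔
      ∀ i, IsMorphism f (toCoaction (factor p φ i)) (toCoaction (factor p ψ i)) := by
  rw [hφ.eq_prod, hψ.eq_prod, isMorphism_toCoaction_iff]
  simp only [isMorphism_toCoaction_iff]
  refine ⟨fun h i => ?_, intertwines_list_prod⟩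
  rw [prod_factor_eq_expProd hn hV hφ.nilpotent, prod_factor_eq_expProd hn hW hψ.nilpotent] at h
  exact intertwines_factor hn hV hW i (hφ.nilpotent i) (hψ.nilpotent i)
    (comp_eq_of_intertwines_expProd hn hV hW hφ.nilpotent hψ.nilpotent h i)

end MainResults

end UnipotentRep

open UnipotentRep in
theorem mainTheorem5_general {k V W : Type*} [Field k] [AddCommGroup V] [Module k V]
    [AddCommGroup W] [Module k W] [FiniteDimensional k V] [FiniteDimensional k W] {p n : ℕ}
    [Fact p.Prime] [CharP k p] (hn : n ≤ p) (hV : Module.finrank k V ≤ p)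
    (hW : Module.finrank k W ≤ p) (Φ : V →ₗ[k] V ⊗[k] CoordRing k n)
    (Ψ : W →ₗ[k] W ⊗[k] CoordRing k n) (hΦ : IsRepresentation Φ) (hΨ : IsRepresentation Ψ) :
    (∃ (m : ℕ) (φ : Fin (m + 1) → (strictUpper k n →ₗ⁅k⁆ Module.End k V))
        (ψ : Fin (m + 1) → (strictUpper k n →ₗ⁅k⁆ Module.End k W)),
      IsDecomposition p φ Φ ∧ IsDecomposition p ψ Ψ) ∧
    ∀ (m : ℕ) (φ : Fin (m + 1) → (strictUpper k n →ₗ⁅k⁆ Module.End k V))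
      (ψ : Fin (m + 1) → (strictUpper k n →ₗ⁅k⁆ Module.End k W)),
      IsDecomposition p φ Φ → IsDecomposition p ψ Ψ →
      (∀ i, IsRepresentation (toCoaction (factor p φ i)) ∧
        IsRepresentation (toCoaction (factor p ψ i))) ∧
      ∀ f : V →ₗ[k] W, IsMorphism f Φ Ψ ↔
        ∀ i, IsMorphism f (toCoaction (factor p φ i)) (toCoaction (factor p ψ i)) := by
  refine ⟨?_, fun m φ ψ hφ hψ => ⟨fun i =>
    ⟨hφ.isRepresentation_factor hn hV i, hψ.isRepresentation_factor hn hW i⟩,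
    hφ.isMorphism_iff hψ hn hV hW⟩⟩
  obtain ⟨D, hD⟩ := exists_forall_ge_exists_isDecomposition hn hV hΦ
  obtain ⟨D', hD'⟩ := exists_forall_ge_exists_isDecomposition hn hW hΨ
  obtain ⟨φ, hφ⟩ := hD (max D D') (le_max_left _ _)
  obtain ⟨ψ, hψ⟩ := hD' (max D D') (le_max_right _ _)
  exact ⟨_, φ, ψ, hφ, hψ⟩

theorem mainTheorem5 {k V W : Type*} [Field k] [AddCommGroup V] [Module k V]
    [AddCommGroup W] [Module k W] [FiniteDimensional k V] [FiniteDimensional k W]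
    (p n d : ℕ) [Fact p.Prime] [CharP k p] (hp : max n (2 * d) ≤ p)
    (hV : Module.finrank k V ≤ d) (hW : Module.finrank k W ≤ d)
    (Φ : V →ₗ[k] V ⊗[k] UnipotentRep.CoordRing k n)
    (Ψ : W →ₗ[k] W ⊗[k] UnipotentRep.CoordRing k n)
    (hΦ : UnipotentRep.IsRepresentation Φ) (hΨ : UnipotentRep.IsRepresentation Ψ) :
    (∃ (m : ℕ) (φ : Fin (m + 1) → (UnipotentRep.strictUpper k n →ₗ⁅k⁆ Module.End k V))
        (ψ : Fin (m + 1) → (UnipotentRep.strictUpper k n →ₗ⁅k⁆ Module.End k W)),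
      UnipotentRep.IsDecomposition p φ Φ ∧ UnipotentRep.IsDecomposition p ψ Ψ) ∧
    ∀ (m : ℕ) (φ : Fin (m + 1) → (UnipotentRep.strictUpper k n →ₗ⁅k⁆ Module.End k V))
      (ψ : Fin (m + 1) → (UnipotentRep.strictUpper k n →ₗ⁅k⁆ Module.End k W)),
      UnipotentRep.IsDecomposition p φ Φ → UnipotentRep.IsDecomposition p ψ Ψ →
      (∀ i, UnipotentRep.IsRepresentation (UnipotentRep.toCoaction (UnipotentRep.factor p φ i)) ∧
        UnipotentRep.IsRepresentation (UnipotentRep.toCoaction (UnipotentRep.factor p ψ i))) ∧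
      ∀ f : V →ₗ[k] W, UnipotentRep.IsMorphism f Φ Ψ ↔
        ∀ i, UnipotentRep.IsMorphism f (UnipotentRep.toCoaction (UnipotentRep.factor p φ i))
          (UnipotentRep.toCoaction (UnipotentRep.factor p ψ i)) := by
  exact mainTheorem5_general (by omega) (by omega) (by omega) Φ Ψ hΦ hΨ
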